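/- Let $\mathcal X\subset\mathbb R^d$ be compact and $\mathcal Y=\{1,-1\}$. Let $K:\mathcal X\times\mathcal X\to\mathbb R$ be a universal kernel, i.e. a continuous symmetric positive semidefinite kernel whose reproducing kernel Hilbert space is dense in the space $C(\mathcal X)$ of continuous functions with the uniform norm. Fix $\rho>0$ and put $$C_\rho(z)=\frac{\log\left[1+\exp\frac{1-z}{\rho}\right]}{\log\left[1+\exp\frac1\rho\right]},\qquad z\in\mathbb R .$$ Let $(\gamma_n)$ be a sequence of positive reals with $\gamma_n\to 0$. For training data $\mathcal T=\{(x_i,y_i)\}_{i=1}^n\subset\mathcal X\times\mathcal Y$, $n\ge 1$, consider the problem $$\min_{\alpha\in\mathbb R,\ \beta\in\mathbb R^n}\ \frac1n\sum_{i=1}^n C_\rho\big(y_if(x_i)\big)+\frac{\gamma_n}{2}\,\beta'\mathbf K\beta,\qquad f(x)=\alpha+\sum_{j=1}^n\beta_jK(x,x_j),\tag{1}$$ where $\mathbf K=[K(x_i,x_j)]_{i,j}$. The classifier based on (1) assigns to $\mathcal T$ a decision function $f_{\mathcal T}=f$ given by a minimizer $(\alpha,\beta)$ of (1) if both labels occur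 in $\mathcal T$; if all labels equal the same $y$ (in which case (1) has no minimizer, its infimum being approached only as $y\alpha\to\infty$), $f_{\mathcal T}$ is a constant of the sign of $y$. The classifier based on (1) with $\alpha=0$ assigns to $\mathcal T$ a decision function given by a minimizer over $\beta$ of the objective with $\alpha=0$. For a probability distribution $P$ on $\mathcal X\times\mathcal Y$ and a measurable $f:\mathcal X\to\mathbb R$, let $\Psi_f=P\{(Y=1,\ f(X)\le 0)\text{ or }(Y=-1,\ f(X)>0)\}$ be the generalization error, and let $\hat\Psi=\inf_f\Psi_f$, over all measurable $f$, be the Bayes error. A classifier is universally consistent if, for every $P$ and i.i.d. training data from $P$, $\Psi_{f_{\mathcal T}}\to\hat\Psi$ in probability as $n\to\infty$, and strongly universally consistent if the convergence is almost sure. Then both kinds of classifier exist (the required minimizers always exist), and the following hold. 1. If $n\gamma_n^2/\log n\to\infty$, then every classifier based on (1) is strongly universally consistent. 2. If $n\gamma_n^2\to\infty$, then every classifier based on (1) with $\alpha=0$ is universally consistent. -/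

import Mathlib

open MeasureTheory Filter Topology

/-- The label set `{1, -1}`. -/
abbrev Label : Type := ({1, -1} : Set ℝ)

/-- The C-loss `C_{ρ,u}(z) = u / log(1 + exp(u/ρ)) * log(1 + exp((u - z)/ρ))`. -/
noncomputable def cLoss (ρ u z : ℝ) : ℝ :=
  u / Real.log (1 + Real.exp (u / ρ)) * Real.log (1 + Real.exp ((u - z) / ρ))

section Kernel

/-- A real kernel as an operator-valued kernel (`K x y` acts on `ℝ` by multiplication), the form in
which Mathlib's construction of the RKHS of a kernel takes it. -/
noncomputable def opKernel {𝓧 : Type*} (K : 𝓧 → 𝓧 → ℝ) : Matrix 𝓧 𝓧 (ℝ →L[ℝ] ℝ) :=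
  Matrix.of fun x y => K x y • ContinuousLinearMap.id ℝ ℝ

theorem opKernel_posSemidef {𝓧 : Type*} {K : 𝓧 → 𝓧 → ℝ} (hK : (Matrix.of K).PosSemidef) :
    (opKernel K).PosSemidef := by
  have h3 := (RKHS.posSemidef_tfae (K := opKernel K)).out 0 2
  refine h3.mpr ⟨?_, fun v => ?_⟩
  · ext x y
    have h : K y x = K x y := by simpa using hK.isHermitian.apply x y
    have h1 : star (ContinuousLinearMap.id ℝ ℝ) = ContinuousLinearMap.id ℝ ℝ := star_one _
    simp [opKernel, Matrix.conjTranspose_apply, h, h1]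
  · have h := hK.2 v
    rw [Finsupp.sum_comm] at h
    simpa [opKernel, mul_comm, mul_left_comm, mul_assoc] using h

/-- The set of functions belonging to the reproducing kernel Hilbert space of the positive
semidefinite kernel `K`. -/
def rkhsFunctions {𝓧 : Type*} (K : 𝓧 → 𝓧 → ℝ) (hK : (Matrix.of K).PosSemidef) : Set (𝓧 → ℝ) :=
  haveI : Fact (opKernel K).PosSemidef := ⟨opKernel_posSemidef hK⟩
  {g | ∃ h : RKHS.OfKernel (opKernel K), ⇑h = g}

/-- A universal kernel: a continuous, symmetric, positive semidefinite kernel whose RKHS is dense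
in the space of continuous functions (the topology of `C(𝓧, ℝ)` is that of uniform
convergence when `𝓧` is compact). -/
structure IsUniversalKernel {𝓧 : Type*} [TopologicalSpace 𝓧] (K : 𝓧 → 𝓧 → ℝ) : Prop where
  continuous : Continuous (Function.uncurry K)
  posSemidef : (Matrix.of K).PosSemidef
  dense : Dense {g : C(𝓧, ℝ) | ⇑g ∈ rkhsFunctions K posSemidef}

end Kernel

section Consistency

variable {𝓧 : Type*} [MeasurableSpace 𝓧]

/-- The generalization error
`E_X [ 1[f(X) ≤ 0] η(X) + 1[f(X) > 0] (1 - η(X)) ]` of the rule that predicts `1` where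
`f > 0` and `-1` where `f ≤ 0`, i.e. the probability that the predicted label is wrong. -/
noncomputable def generalizationError (P : Measure (𝓧 × Label)) (f : 𝓧 → ℝ) : ℝ :=
  P.real {z | ((z.2 : ℝ) = 1 ∧ f z.1 ≤ 0) ∨ ((z.2 : ℝ) = -1 ∧ 0 < f z.1)}

/-- The optimal Bayes error: the infimum of the generalization error over measurable functions. -/
noncomputable def bayesError (P : Measure (𝓧 × Label)) : ℝ :=
  ⨅ f : {f : 𝓧 → ℝ // Measurable f}, generalizationError P f

/-- A family `f` assigning to every training set of size `n` a decision function is universally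
consistent if, for every distribution `P` and i.i.d. training data drawn from `P`, the
generalization error converges to the Bayes error in probability. -/
def UniversallyConsistent (f : ∀ n : ℕ, (Fin n → 𝓧 × Label) → 𝓧 → ℝ) : Prop :=
  ∀ (P : Measure (𝓧 × Label)) [IsProbabilityMeasure P],
    TendstoInMeasure (Measure.infinitePi fun _ : ℕ => P)
      (fun n ω => generalizationError P (f n fun i => ω i)) atTop (fun _ => bayesError P)

/-- Strong universal consistency: the convergence is almost sure. -/
def StronglyUniversallyConsistent (f : ∀ n : ℕ, (Fin n → 𝓧 × Label) → 𝓧 → ℝ) : Prop :=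
  ∀ (P : Measure (𝓧 × Label)) [IsProbabilityMeasure P],
    ∀ᵐ ω ∂(Measure.infinitePi fun _ : ℕ => P),
      Tendsto (fun n : ℕ => generalizationError P (f n fun i => ω i)) atTop (𝓝 (bayesError P))

end Consistency

section Classifier

variable {𝓧 : Type*}

/-- The decision function `x ↦ α + ∑ j, β_j K(x, x_j)`. -/
noncomputable def kernelExpansion (K : 𝓧 → 𝓧 → ℝ) {n : ℕ} (T : Fin n → 𝓧 × Label)
    (α : ℝ) (β : Fin n → ℝ) (x : 𝓧) : ℝ :=
  α + ∑ j, β j * K x (T j).1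

/-- The regularized empirical C-loss
`(1/n) ∑ i, C_{ρ,1}(y_i f(x_i)) + (γ/2) β' K β`, where `f = α + ∑ j, β_j K(·, x_j)`. -/
noncomputable def cRegObjective (K : 𝓧 → 𝓧 → ℝ) (ρ γ : ℝ) {n : ℕ} (T : Fin n → 𝓧 × Label)
    (α : ℝ) (β : Fin n → ℝ) : ℝ :=
  1 / (n : ℝ) * ∑ i, cLoss ρ 1 (((T i).2 : ℝ) * kernelExpansion K T α β (T i).1) +
    γ / 2 * ∑ i, ∑ j, β i * K (T i).1 (T j).1 * β j

/-- `f` is a classifier with offset based on the regularized empirical C-loss. On training data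
containing both labels, the decision function is given by a minimizer. If all labels are equal to
`y`, the infimum is approached only as `y * α → ∞` and there is no minimizer; the classifier then
predicts `y` everywhere, with a constant decision function of the sign of `y`. -/
def IsCRegClassifier (K : 𝓧 → 𝓧 → ℝ) (ρ : ℝ) (γ : ℕ → ℝ)
    (f : ∀ n : ℕ, (Fin n → 𝓧 × Label) → 𝓧 → ℝ) : Prop :=
  ∀ (n : ℕ), 0 < n → ∀ T : Fin n → 𝓧 × Label,
    ((∃ i j, (T i).2 ≠ (T j).2) →
      ∃ (α : ℝ) (β : Fin n → ℝ),
        (∀ (α' : ℝ) (β' : Fin n → ℝ),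
          cRegObjective K ρ (γ n) T α β ≤ cRegObjective K ρ (γ n) T α' β') ∧
        f n T = kernelExpansion K T α β) ∧
    (∀ y : Label, (∀ i, (T i).2 = y) → ∃ a : ℝ, 0 < (y : ℝ) * a ∧ f n T = fun _ => a)

/-- `f` is a classifier without offset (`α = 0`) based on the regularized empirical C-loss. -/
def IsCRegClassifierNoOffset (K : 𝓧 → 𝓧 → ℝ) (ρ : ℝ) (γ : ℕ → ℝ)
    (f : ∀ n : ℕ, (Fin n → 𝓧 × Label) → 𝓧 → ℝ) : Prop :=
  ∀ (n : ℕ), 0 < n → ∀ T : Fin n → 𝓧 × Label,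
    ∃ β : Fin n → ℝ,
      (∀ β' : Fin n → ℝ, cRegObjective K ρ (γ n) T 0 β ≤ cRegObjective K ρ (γ n) T 0 β') ∧
      f n T = kernelExpansion K T 0 β

end Classifier

/-! Only a few properties of the loss matter, collected in `IsMarginLoss`: it is convex, its
derivative is bounded and Lipschitz, and it decreases at `0`. A feature map `Φ` turns (1) into a
regularized risk over a Hilbert space `H`, where the representer theorem makes minimizing over
coefficients equivalent to minimizing over all of `H`.

The core is a stability argument that replaces a uniform law of large numbers. For a fixed offset
`α'`, the stationarity equation of the population problem has a solution `h`, which does not depend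
on the sample (`exists_stationary`). Convexity and the quadratic regularizer show that an empirical
minimizer `g` is close to `h` as soon as the empirical gradient at `h` is within `γη` of its mean
(`sq_norm_sub_stationary_le`). Hence only the gradient at `h`, the loss at `h` and the loss at one
fixed competitor `g₀` must concentrate (`risk_le_of_deviations`). Since `h` and the offsets are
`O(1/γ)`, Hoeffding's inequality in Hilbert space bounds the failure probability by a multiple of
`exp(-c n γ²)`. Hoeffding itself follows from a bound on the expectation of the hyperbolic cosine of
the norm.

Calibration turns small risk into small classification error: the square of the excess error is at
most a constant times the excess risk (`exists_sq_excess_le`). Universality supplies the competitor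
`g₀` of nearly optimal risk (`exists_competitor`).

With `α = 0` one stationary point suffices and `n γ² → ∞` gives convergence in probability. With an
offset, `α` depends on the sample, but both labels have frequency bounded below, so `|α| ≤ A/γ`. A
grid of mesh `γη` on this range has `O(1/γ²) = O(n)` points. The union bound over it is summable
when `n γ² / log n → ∞`, and Borel–Cantelli gives almost sure convergence. If one label has
probability one, the classifier with offset is optimal almost surely. -/

/-! ### Smooth convex margin losses -/

/-- A smooth convex margin loss `φ` with derivative `φ'`, normalized by `φ 0 = 1`: nonnegative,
lying above its tangents, with `φ'` bounded by `L` and `M`-Lipschitz, and decreasing at `0`. -/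
structure IsMarginLoss (φ φ' : ℝ → ℝ) (L M : ℝ) : Prop where
  nonneg : ∀ a, 0 ≤ φ a
  zero : φ 0 = 1
  tangent : ∀ a b, φ a + φ' a * (b - a) ≤ φ b
  bound : ∀ a, |φ' a| ≤ L
  lip : ∀ a b, |φ' a - φ' b| ≤ M * |a - b|
  L_pos : 0 < L
  M_pos : 0 < M
  neg : φ' 0 < 0

namespace IsMarginLoss

variable {φ φ' : ℝ → ℝ} {L M : ℝ}

theorem sub_le (h : IsMarginLoss φ φ' L M) (a b : ℝ) : φ a - φ b ≤ L * |a - b| := by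
  have h1 := h.tangent a b
  have h2 : φ' a * (a - b) ≤ |φ' a| * |a - b| := by
    rw [← abs_mul]; exact le_abs_self _
  have h3 := mul_le_mul_of_nonneg_right (h.bound a) (abs_nonneg (a - b))
  nlinarith

theorem abs_sub_le (h : IsMarginLoss φ φ' L M) (a b : ℝ) : |φ a - φ b| ≤ L * |a - b| := by
  rw [abs_le]
  have h1 := h.sub_le b a
  rw [abs_sub_comm] at h1
  exact ⟨by linarith, h.sub_le a b⟩

theorem le_one_add (h : IsMarginLoss φ φ' L M) (a : ℝ) : φ a ≤ 1 + L * |a| := by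
  have := h.sub_le a 0
  rw [h.zero, sub_zero] at this
  linarith

/-- The tangent at `b` bounds `φ b - φ a` by `φ' b * (b - a)`; replacing `φ' b` by `φ' a` costs the
quadratic term. This avoids integration, at the price of `M` instead of `M / 2`. -/
theorem quadratic (h : IsMarginLoss φ φ' L M) (a b : ℝ) :
    φ b ≤ φ a + φ' a * (b - a) + M * (b - a) ^ 2 := by
  have h1 := h.tangent b a
  have h2 : (φ' b - φ' a) * (b - a) ≤ |φ' b - φ' a| * |b - a| := by
    rw [← abs_mul]; exact le_abs_self _
  have h3 := mul_le_mul_of_nonneg_right (h.lip b a) (abs_nonneg (b - a))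
  have h4 : |b - a| * |b - a| = (b - a) ^ 2 := by rw [abs_mul_abs_self, sq]
  rw [mul_assoc, h4] at h3
  linarith [h2.trans h3]

theorem mono (h : IsMarginLoss φ φ' L M) (a b : ℝ) : 0 ≤ (φ' a - φ' b) * (a - b) := by
  have h1 := h.tangent a b
  have h2 := h.tangent b a
  nlinarith

theorem continuous (h : IsMarginLoss φ φ' L M) : Continuous φ :=
  (LipschitzWith.of_dist_le_mul (K := NNReal.mk L h.L_pos.le)
    (fun a b => by simpa [Real.dist_eq] using h.abs_sub_le a b)).continuous

theorem continuous' (h : IsMarginLoss φ φ' L M) : Continuous φ' :=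
  (LipschitzWith.of_dist_le_mul (K := NNReal.mk M h.M_pos.le)
    (fun a b => by simpa [Real.dist_eq] using h.lip a b)).continuous

end IsMarginLoss

theorem Real.abs_sigmoid_sub_le (a b : ℝ) : |Real.sigmoid a - Real.sigmoid b| ≤ |a - b| := by
  have := Convex.norm_image_sub_le_of_norm_hasDerivWithin_le (f := Real.sigmoid)
    (f' := fun x => Real.sigmoid x * (1 - Real.sigmoid x)) (s := Set.univ) (C := 1)
    (x := b) (y := a)
    (fun x _ => (Real.hasDerivAt_sigmoid x).hasDerivWithinAt)
    (fun x _ => by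
      have h0 := Real.sigmoid_nonneg x
      have h1 := Real.sigmoid_le_one x
      rw [Real.norm_eq_abs, abs_of_nonneg (mul_nonneg h0 (by linarith))]
      nlinarith) convex_univ trivial trivial
  simpa [Real.norm_eq_abs] using this

theorem Real.log_one_add_exp_tangent (a b : ℝ) :
    Real.log (1 + Real.exp a) + Real.sigmoid a * (b - a) ≤ Real.log (1 + Real.exp b) := by
  have ha := Real.exp_pos a
  have hs : Real.sigmoid a = Real.exp a / (1 + Real.exp a) := by
    rw [Real.sigmoid_def, Real.exp_neg]; field_simp; ring
  -- Weighted convexity of `exp` between `0` and `b - a` with weight `sigmoid a`; the right side is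
  -- `(1 + exp b) / (1 + exp a)`, so taking logarithms gives the tangent inequality.
  have key : Real.exp (Real.sigmoid a * (b - a)) ≤
      (1 - Real.sigmoid a) * Real.exp 0 + Real.sigmoid a * Real.exp (b - a) := by
    obtain ⟨-, hcx⟩ := convexOn_exp
    have := hcx (Set.mem_univ 0) (Set.mem_univ (b - a)) (sub_nonneg.mpr (Real.sigmoid_le_one a))
      (Real.sigmoid_nonneg a) (sub_add_cancel 1 (Real.sigmoid a))
    simpa using this
  have h2 : (1 - Real.sigmoid a) * Real.exp 0 + Real.sigmoid a * Real.exp (b - a) =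
      (1 + Real.exp b) / (1 + Real.exp a) := by
    rw [hs, Real.exp_sub, Real.exp_zero]; field_simp; ring
  rw [h2, ← Real.le_log_iff_exp_le (by positivity), Real.log_div (by positivity)
    (by positivity)] at key
  linarith

/-- The C-loss (with `u = 1`) is a smooth convex margin loss. -/
theorem exists_isMarginLoss_cLoss {ρ : ℝ} (hρ : 0 < ρ) :
    ∃ φ' L M, IsMarginLoss (cLoss ρ 1) φ' L M := by
  have hl : 0 < Real.log (1 + Real.exp (1 / ρ)) :=
    Real.log_pos (by linarith [Real.exp_pos (1 / ρ)])
  set c := 1 / Real.log (1 + Real.exp (1 / ρ)) with hc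
  have hc0 : 0 < c := by positivity
  have hd : 0 < c / ρ := by positivity
  refine ⟨fun z => -(c / ρ) * Real.sigmoid ((1 - z) / ρ), c / ρ, c / ρ / ρ,
    fun a => ?_, ?_, fun a b => ?_, fun a => ?_, fun a b => ?_, hd, by positivity, ?_⟩
  · exact mul_nonneg hc0.le (Real.log_nonneg (by linarith [Real.exp_pos ((1 - a) / ρ)]))
  · simp only [cLoss, sub_zero]; field_simp
  · have := mul_le_mul_of_nonneg_left
      (Real.log_one_add_exp_tangent ((1 - a) / ρ) ((1 - b) / ρ)) hc0.le
    simp only [cLoss, ← hc]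
    refine le_trans (le_of_eq ?_) this
    field_simp; ring
  · rw [abs_mul, abs_neg, abs_of_pos hd, abs_of_nonneg (Real.sigmoid_nonneg _)]
    exact mul_le_of_le_one_right hd.le (Real.sigmoid_le_one _)
  · rw [← mul_sub, abs_mul, abs_neg, abs_of_pos hd]
    have := Real.abs_sigmoid_sub_le ((1 - a) / ρ) ((1 - b) / ρ)
    have h2 : (1 - a) / ρ - (1 - b) / ρ = (b - a) / ρ := by ring
    rw [h2, abs_div, abs_of_pos hρ, abs_sub_comm b a] at this
    calc _ ≤ c / ρ * (|a - b| / ρ) := mul_le_mul_of_nonneg_left this hd.le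
      _ = _ := by ring
  · have := Real.sigmoid_pos ((1 - 0) / ρ)
    simp only [neg_mul, Left.neg_neg_iff]; positivity

/-! ### Zeros of strongly monotone maps -/

/-- A strongly monotone Lipschitz map on a Hilbert space has a zero. -/
theorem exists_zero_of_stronglyMonotone {H : Type*} [NormedAddCommGroup H] [InnerProductSpace ℝ H]
    [CompleteSpace H] (G : H → H) {m Λ : ℝ} (hm : 0 < m)
    (hmono : ∀ a b, m * ‖a - b‖ ^ 2 ≤ inner ℝ (G a - G b) (a - b))
    (hlip : ∀ a b, ‖G a - G b‖ ≤ Λ * ‖a - b‖) : ∃ h, G h = 0 := by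
  rcases subsingleton_or_nontrivial H with hs | hs
  · exact ⟨0, Subsingleton.elim _ _⟩
  have hmΛ : m ≤ Λ := by
    obtain ⟨a, b, hab⟩ := exists_pair_ne H
    have h0 : 0 < ‖a - b‖ := norm_pos_iff.mpr (sub_ne_zero.mpr hab)
    have h1 := (hmono a b).trans ((real_inner_le_norm _ _).trans
      (mul_le_mul_of_nonneg_right (hlip a b) h0.le))
    have h2 : 0 < ‖a - b‖ ^ 2 := by positivity
    nlinarith
  have hΛ : 0 < Λ := hm.trans_le hmΛ
  -- The step size minimizing the squared contraction factor `1 - 2 t m + t² Λ²` of `a ↦ a - t • G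
  -- a`; the minimum is `q`, and `m ≤ Λ` makes it nonnegative.
  set t := m / Λ ^ 2 with ht
  have ht0 : 0 < t := by positivity
  set q := 1 - m ^ 2 / Λ ^ 2 with hq
  have hq0 : 0 ≤ q := by
    rw [hq, sub_nonneg, div_le_one (by positivity)]
    exact pow_le_pow_left₀ hm.le hmΛ 2
  have hq1 : q < 1 := by
    have : 0 < m ^ 2 / Λ ^ 2 := by positivity
    linarith
  have hcontr : ContractingWith (NNReal.mk √q (Real.sqrt_nonneg q)) (fun a => a - t • G a) := by
    refine ⟨?_, LipschitzWith.of_dist_le_mul fun a b => ?_⟩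
    · rw [← NNReal.coe_lt_coe]
      simpa using (Real.sqrt_lt' one_pos).mpr (by simpa using hq1)
    · rw [dist_eq_norm, dist_eq_norm]
      have e : a - t • G a - (b - t • G b) = (a - b) - t • (G a - G b) := by
        rw [smul_sub]; abel
      rw [e]
      refine abs_le_of_sq_le_sq' ?_ (by positivity) |>.2
      rw [norm_sub_sq_real, mul_pow, NNReal.coe_mk, Real.sq_sqrt hq0, inner_smul_right, norm_smul,
        Real.norm_of_nonneg ht0.le, real_inner_comm]
      have h1 := hmono a b
      have h2 := pow_le_pow_left₀ (norm_nonneg _) (hlip a b) 2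
      have h3 := mul_le_mul_of_nonneg_left h1 ht0.le
      have h4 := mul_le_mul_of_nonneg_left h2 (sq_nonneg t)
      have h5 : t ^ 2 * (Λ * ‖a - b‖) ^ 2 = m ^ 2 / Λ ^ 2 * ‖a - b‖ ^ 2 := by
        rw [ht]; field_simp
      have h6 : t * (m * ‖a - b‖ ^ 2) = m ^ 2 / Λ ^ 2 * ‖a - b‖ ^ 2 := by
        rw [ht]; field_simp
      rw [mul_pow t]
      rw [hq]
      linarith
  refine ⟨hcontr.fixedPoint, ?_⟩
  have h := hcontr.fixedPoint_isFixedPt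
  have h' : t • G hcontr.fixedPoint = 0 := by
    have : hcontr.fixedPoint - t • G hcontr.fixedPoint = hcontr.fixedPoint := h
    exact sub_eq_self.mp this
  exact (smul_eq_zero.mp h').resolve_left ht0.ne'

/-! ### Hoeffding's inequality in Hilbert space -/

section Concentration

/-- The power series of `cosh √s` in `s` has nonnegative coefficients `1 / (2n)!`, and each `s ^ n`
is convex on `[0, ∞)`. -/
theorem convexOn_cosh_sqrt : ConvexOn ℝ (Set.Ici 0) (fun s => Real.cosh √s) := by
  have hs : ∀ s : ℝ, 0 ≤ s →
      HasSum (fun n : ℕ => s ^ n / ((2 * n).factorial : ℝ)) (Real.cosh √s) := fun s hs => by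
    have := Real.hasSum_cosh √s
    simpa only [pow_mul, Real.sq_sqrt hs] using this
  refine ⟨convex_Ici 0, fun x hx y hy a b ha hb hab => ?_⟩
  have hx' : 0 ≤ x := hx
  have hy' : 0 ≤ y := hy
  simp only [smul_eq_mul]
  refine hasSum_le (fun n => ?_) (hs (a * x + b * y) (by positivity))
    (((hs x hx').mul_left a).add ((hs y hy').mul_left b))
  have h := (convexOn_pow n).2 hx hy ha hb hab
  simp only [smul_eq_mul] at h
  calc (a * x + b * y) ^ n / ((2 * n).factorial : ℝ)
      ≤ (a * x ^ n + b * y ^ n) / ((2 * n).factorial : ℝ) := by gcongr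
    _ = _ := by ring

/-- By convexity of `cosh √s`, the graph lies below its chord between `(a - b)²` and `(a + b)²`,
whose midpoint value is `cosh a * cosh b`. The slope `c` is independent of `u`, so for `u = ⟪v, z⟫`
the linear term vanishes on averaging over a centred `z`. -/
theorem cosh_sqrt_le_cosh_mul_cosh_add {a b : ℝ} (ha : 0 ≤ a) (hb : 0 ≤ b) :
    ∃ c : ℝ, ∀ u, |u| ≤ a * b →
      Real.cosh √(a ^ 2 + 2 * u + b ^ 2) ≤ Real.cosh a * Real.cosh b + c * u := by
  rcases eq_or_lt_of_le (mul_nonneg ha hb) with h0 | h0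
  · refine ⟨0, fun u hu => ?_⟩
    have hu0 : u = 0 := abs_eq_zero.mp (le_antisymm (h0 ▸ hu) (abs_nonneg u))
    rcases mul_eq_zero.mp h0.symm with h | h
    · simp [hu0, h, Real.sqrt_sq hb]
    · simp [hu0, h, Real.sqrt_sq ha]
  · refine ⟨Real.sinh a * Real.sinh b / (a * b), fun u hu => ?_⟩
    rw [abs_le] at hu
    have h1 : -1 ≤ u / (a * b) := by rw [le_div_iff₀ h0]; linarith
    have h2 : u / (a * b) ≤ 1 := by rw [div_le_one h0]; linarith
    obtain ⟨-, hc⟩ := convexOn_cosh_sqrt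
    have := hc (Set.mem_Ici.mpr (sq_nonneg (a + b))) (Set.mem_Ici.mpr (sq_nonneg (a - b)))
      (show 0 ≤ (1 + u / (a * b)) / 2 by linarith) (show 0 ≤ (1 - u / (a * b)) / 2 by linarith)
      (by ring)
    simp only [smul_eq_mul, Real.sqrt_sq_eq_abs, Real.cosh_abs, Real.cosh_add, Real.cosh_sub]
      at this
    have ha' : a ≠ 0 := by rintro rfl; simp at h0
    have hb' : b ≠ 0 := by rintro rfl; simp at h0
    have e : (1 + u / (a * b)) / 2 * (a + b) ^ 2 + (1 - u / (a * b)) / 2 * (a - b) ^ 2 =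
        a ^ 2 + 2 * u + b ^ 2 := by field_simp; ring
    rw [e] at this
    refine this.trans (le_of_eq ?_)
    field_simp; ring

variable {Z : Type*} [MeasurableSpace Z] {E : Type*} [NormedAddCommGroup E] [InnerProductSpace ℝ E]

theorem cosh_norm_add_le {v z : E} {B c : ℝ} (hz : ‖z‖ ≤ B)
    (hc : ∀ u, |u| ≤ ‖v‖ * B →
      Real.cosh √(‖v‖ ^ 2 + 2 * u + B ^ 2) ≤ Real.cosh ‖v‖ * Real.cosh B + c * u) :
    Real.cosh ‖v + z‖ ≤ Real.cosh ‖v‖ * Real.cosh B + c * inner ℝ v z := by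
  refine le_trans ?_ (hc (inner ℝ v z) ((abs_real_inner_le_norm v z).trans
    (mul_le_mul_of_nonneg_left hz (norm_nonneg v))))
  rw [Real.cosh_le_cosh, abs_norm, abs_of_nonneg (Real.sqrt_nonneg _)]
  refine Real.le_sqrt_of_sq_le ?_
  rw [norm_add_sq_real]
  have := pow_le_pow_left₀ (norm_nonneg z) hz 2
  linarith

theorem integrable_cosh_norm_add {E : Type*} [NormedAddCommGroup E] (P : Measure Z)
    [IsProbabilityMeasure P] {F : Z → E} (hF : StronglyMeasurable F) {B : ℝ}
    (hB : ∀ z, ‖F z‖ ≤ B) (v : E) :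
    Integrable (fun z => Real.cosh ‖v + F z‖) P := by
  have hB0 : 0 ≤ B := by
    obtain ⟨z⟩ := nonempty_of_isProbabilityMeasure P
    exact (norm_nonneg _).trans (hB z)
  refine Integrable.of_bound (C := Real.cosh (‖v‖ + B)) ?_ (ae_of_all _ fun z => ?_)
  · exact (Real.continuous_cosh.comp_stronglyMeasurable
      (stronglyMeasurable_const.add hF).norm).aestronglyMeasurable
  · rw [Real.norm_of_nonneg (Real.cosh_pos _).le, Real.cosh_le_cosh, abs_norm,
      abs_of_nonneg (by positivity)]
    exact (norm_add_le _ _).trans (by linarith [hB z])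

theorem stronglyMeasurable_sum_pi {E : Type*} [NormedAddCommGroup E] {F : Z → E}
    (hF : StronglyMeasurable F) (n : ℕ) :
    StronglyMeasurable (fun T : Fin n → Z => ∑ i, F (T i)) :=
  Finset.stronglyMeasurable_fun_sum _ fun i _ => hF.comp_measurable (measurable_pi_apply i)

theorem integral_cosh_norm_add_le [CompleteSpace E] (P : Measure Z) [IsProbabilityMeasure P]
    {F : Z → E} (hF : StronglyMeasurable F) {B : ℝ} (hB : ∀ z, ‖F z‖ ≤ B) (h0 : ∫ z, F z ∂P = 0)
    (v : E) :
    ∫ z, Real.cosh ‖v + F z‖ ∂P ≤ Real.cosh ‖v‖ * Real.cosh B := by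
  have hB0 : 0 ≤ B := by
    obtain ⟨z⟩ := nonempty_of_isProbabilityMeasure P
    exact (norm_nonneg _).trans (hB z)
  obtain ⟨c, hc⟩ := cosh_sqrt_le_cosh_mul_cosh_add (norm_nonneg v) hB0
  have hFi : Integrable F P := Integrable.of_bound hF.aestronglyMeasurable B (ae_of_all _ hB)
  have hin : Integrable (fun z => inner ℝ v (F z)) P := hFi.const_inner v
  have hcosh := integrable_cosh_norm_add P hF hB v
  calc ∫ z, Real.cosh ‖v + F z‖ ∂P
      ≤ ∫ z, (Real.cosh ‖v‖ * Real.cosh B + c * inner ℝ v (F z)) ∂P :=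
        integral_mono hcosh ((integrable_const _).add (hin.const_mul c))
          (fun z => cosh_norm_add_le (hB z) hc)
    _ = Real.cosh ‖v‖ * Real.cosh B := by
        rw [integral_add (integrable_const _) (hin.const_mul c), integral_const_mul c,
          integral_inner hFi, h0]
        simp

/-- Induction that integrates out one summand at a time, each contributing a factor `cosh B`. The
starting vector `v` is arbitrary because the peeled summand is absorbed into it. -/
theorem lintegral_cosh_norm_sum_le [CompleteSpace E] (P : Measure Z) [IsProbabilityMeasure P]
    {F : Z → E} (hF : StronglyMeasurable F) {B : ℝ} (hB : ∀ z, ‖F z‖ ≤ B) (h0 : ∫ z, F z ∂P = 0)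
    (n : ℕ) (v : E) :
    ∫⁻ T : Fin n → Z, ENNReal.ofReal (Real.cosh ‖v + ∑ i, F (T i)‖) ∂(Measure.pi fun _ => P) ≤
      ENNReal.ofReal (Real.cosh ‖v‖ * Real.cosh B ^ n) := by
  induction n generalizing v with
  | zero => simp
  | succ n ih =>
    have hmp := measurePreserving_piFinSuccAbove (fun _ : Fin (n + 1) => P) 0
    have hmeas : ∀ n : ℕ, ∀ w : E, Measurable fun T : Fin n → Z =>
        ENNReal.ofReal (Real.cosh ‖w + ∑ i, F (T i)‖) := fun n w =>
      (Real.continuous_cosh.measurable.comp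
        (stronglyMeasurable_const.add (stronglyMeasurable_sum_pi
          hF n)).norm.measurable).ennreal_ofReal
    have hmeas2 : Measurable fun p : Z × (Fin n → Z) =>
        ENNReal.ofReal (Real.cosh ‖v + (F p.1 + ∑ i, F (p.2 i))‖) :=
      (Real.continuous_cosh.measurable.comp
        (stronglyMeasurable_const.add ((hF.comp_measurable measurable_fst).add
          ((stronglyMeasurable_sum_pi hF n).comp_measurable
            measurable_snd))).norm.measurable).ennreal_ofReal
    have hone := integrable_cosh_norm_add P hF hB v
    calc ∫⁻ T : Fin (n + 1) → Z, ENNReal.ofReal (Real.cosh ‖v + ∑ i, F (T i)‖)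
          ∂(Measure.pi fun _ => P)
        = ∫⁻ p : Z × (Fin n → Z), ENNReal.ofReal (Real.cosh ‖v + (F p.1 + ∑ i, F (p.2 i))‖)
            ∂(P.prod (Measure.pi fun _ => P)) := by
          rw [← hmp.lintegral_comp hmeas2]
          refine lintegral_congr fun T => ?_
          rw [Fin.sum_univ_succ]
          rfl
      _ = ∫⁻ z, ∫⁻ T : Fin n → Z, ENNReal.ofReal (Real.cosh ‖(v + F z) + ∑ i, F (T i)‖)
            ∂(Measure.pi fun _ => P) ∂P := by
          rw [lintegral_prod _ hmeas2.aemeasurable]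
          simp only [add_assoc]
      _ ≤ ∫⁻ z, ENNReal.ofReal (Real.cosh ‖v + F z‖ * Real.cosh B ^ n) ∂P :=
          lintegral_mono fun z => ih (v + F z)
      _ = ENNReal.ofReal (∫ z, Real.cosh ‖v + F z‖ * Real.cosh B ^ n ∂P) := by
          rw [ofReal_integral_eq_lintegral_ofReal (hone.mul_const _)
            (ae_of_all _ fun z =>
              mul_nonneg (Real.cosh_pos _).le (pow_nonneg (Real.cosh_pos _).le _))]
      _ ≤ ENNReal.ofReal (Real.cosh ‖v‖ * Real.cosh B ^ (n + 1)) := by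
          refine ENNReal.ofReal_le_ofReal ?_
          rw [integral_mul_const, pow_succ, mul_comm (Real.cosh B ^ n), ← mul_assoc]
          exact mul_le_mul_of_nonneg_right (integral_cosh_norm_add_le P hF hB h0 v)
            (pow_nonneg (Real.cosh_pos _).le _)

/-- The empirical mean of `F` over the sample `T`. -/
noncomputable def empMean {n : ℕ} (T : Fin n → Z) (F : Z → E) : E := (1 / (n : ℝ)) • ∑ i, F (T i)

/-- Exponential tail bound for sums of centred bounded independent Hilbert space valued random
variables. -/
theorem measure_norm_sum_ge_le [CompleteSpace E] (P : Measure Z) [IsProbabilityMeasure P]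
    {F : Z → E} (hF : StronglyMeasurable F) {B : ℝ} (hB0 : 0 < B) (hB : ∀ z, ‖F z‖ ≤ B)
    (h0 : ∫ z, F z ∂P = 0) {n : ℕ} (hn : 0 < n) {ε : ℝ} (hε : 0 ≤ ε) :
    (Measure.pi fun _ : Fin n => P) {T | n * ε ≤ ‖∑ i, F (T i)‖} ≤
      ENNReal.ofReal (2 * Real.exp (-(n * ε ^ 2 / (2 * B ^ 2)))) := by
  have hn' : (0 : ℝ) < n := by exact_mod_cast hn
  -- The minimizer of the Chernoff exponent `l² B² / 2 - l ε`. The factor `2` in the bound comes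
  -- from `exp x / 2 ≤ cosh x`.
  set l := ε / B ^ 2 with hl
  have hl0 : 0 ≤ l := by positivity
  have hmgf := lintegral_cosh_norm_sum_le P (F := fun z => l • F z) (B := l * B)
    (hF.const_smul l) (fun z => by
      rw [norm_smul, Real.norm_of_nonneg hl0]
      exact mul_le_mul_of_nonneg_left (hB z) hl0)
    (by rw [integral_smul, h0, smul_zero]) n 0
  simp only [← Finset.smul_sum, zero_add, norm_smul, Real.norm_of_nonneg hl0, norm_zero,
    Real.cosh_zero, one_mul] at hmgf
  have hmeas : Measurable fun T : Fin n → Z =>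
      ENNReal.ofReal (Real.cosh (l * ‖∑ i, F (T i)‖)) :=
    (Real.continuous_cosh.measurable.comp
      ((stronglyMeasurable_sum_pi hF n).norm.measurable.const_mul l)).ennreal_ofReal
  have hpos : 0 < Real.cosh (l * (n * ε)) := Real.cosh_pos _
  have hmarkov := meas_ge_le_lintegral_div (μ := Measure.pi fun _ : Fin n => P)
    hmeas.aemeasurable (ε := ENNReal.ofReal (Real.cosh (l * (n * ε))))
    (by simpa using hpos) ENNReal.ofReal_ne_top
  refine (measure_mono fun T hT => ?_).trans (hmarkov.trans
    ((ENNReal.div_le_div_right hmgf _).trans ?_))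
  · have hT' : n * ε ≤ ‖∑ i, F (T i)‖ := hT
    refine ENNReal.ofReal_le_ofReal ?_
    rw [Real.cosh_le_cosh, abs_of_nonneg (by positivity), abs_of_nonneg (by positivity)]
    exact mul_le_mul_of_nonneg_left hT' hl0
  · rw [← ENNReal.ofReal_div_of_pos hpos]
    refine ENNReal.ofReal_le_ofReal ?_
    rw [div_le_iff₀ hpos]
    have h1 : Real.cosh (l * B) ^ n ≤ Real.exp (n * ε ^ 2 / (2 * B ^ 2)) := by
      calc Real.cosh (l * B) ^ n ≤ Real.exp ((l * B) ^ 2 / 2) ^ n :=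
            pow_le_pow_left₀ (Real.cosh_pos _).le (Real.cosh_le_exp_half_sq _) n
        _ = _ := by
            rw [← Real.exp_nat_mul, hl]
            congr 1; field_simp
    have h2 : Real.exp (l * (n * ε)) / 2 ≤ Real.cosh (l * (n * ε)) := by
      rw [Real.cosh_eq]; linarith [Real.exp_pos (-(l * (n * ε)))]
    have h3 : Real.exp (n * ε ^ 2 / (2 * B ^ 2)) =
        Real.exp (-(n * ε ^ 2 / (2 * B ^ 2))) * Real.exp (l * (n * ε)) := by
      rw [← Real.exp_add, hl]; congr 1; field_simp; ring
    have h4 := mul_le_mul_of_nonneg_left h2 (Real.exp_pos (-(n * ε ^ 2 / (2 * B ^ 2)))).le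
    linarith

/-- Hoeffding's inequality for empirical means of a bounded Hilbert space valued function. -/
theorem measure_empMean_sub_integral_ge_le [CompleteSpace E] (P : Measure Z)
    [IsProbabilityMeasure P] {F : Z → E} (hF : StronglyMeasurable F) {B : ℝ} (hB0 : 0 < B)
    (hB : ∀ z, ‖F z‖ ≤ B) {n : ℕ} (hn : 0 < n) {ε : ℝ} (hε : 0 ≤ ε) :
    (Measure.pi fun _ : Fin n => P) {T | ε ≤ ‖empMean T F - ∫ z, F z ∂P‖} ≤
      ENNReal.ofReal (2 * Real.exp (-(n * ε ^ 2 / (8 * B ^ 2)))) := by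
  have hn' : (0 : ℝ) < n := by exact_mod_cast hn
  have hFi : Integrable F P := Integrable.of_bound hF.aestronglyMeasurable B (ae_of_all _ hB)
  have hI : ‖∫ z, F z ∂P‖ ≤ B := by
    simpa using norm_integral_le_of_norm_le_const (ae_of_all P hB)
  -- Centring at most doubles the bound on `F`, whence `8 * B ^ 2` instead of `2 * B ^ 2`.
  have := measure_norm_sum_ge_le P (F := fun z => F z - ∫ z, F z ∂P) (B := 2 * B)
    (hF.sub stronglyMeasurable_const) (by linarith)
    (fun z => (norm_sub_le _ _).trans (by linarith [hB z]))
    (by rw [integral_sub hFi (integrable_const _)]; simp) hn hε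
  have e : 2 * (2 * B) ^ 2 = 8 * B ^ 2 := by ring
  rw [e] at this
  refine (measure_mono fun T hT => ?_).trans this
  have hT' : ε ≤ ‖empMean T F - ∫ z, F z ∂P‖ := hT
  have e2 : ∑ i, (F (T i) - ∫ z, F z ∂P) = (n : ℝ) • (empMean T F - ∫ z, F z ∂P) := by
    rw [Finset.sum_sub_distrib, smul_sub, empMean, smul_smul, mul_one_div_cancel hn'.ne', one_smul]
    simp [Nat.cast_smul_eq_nsmul]
  simp only [Set.mem_ofPred_eq, e2, norm_smul, Real.norm_of_nonneg hn'.le]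
  exact mul_le_mul_of_nonneg_left hT' hn'.le

theorem measurePreserving_infinitePi_fin (P : Measure Z) [IsProbabilityMeasure P] (n : ℕ) :
    MeasurePreserving (fun (ω : ℕ → Z) (i : Fin n) => ω i) (Measure.infinitePi fun _ : ℕ => P)
      (Measure.pi fun _ : Fin n => P) := by
  refine ⟨by fun_prop, ?_⟩
  rw [← Measure.infinitePi_eq_pi]
  exact Measure.map_infinitePi_infinitePi_of_inj (Ω := fun _ => Z) (f := fun i : Fin n => (i : ℕ))
    Fin.val_injective

/-- Hoeffding's inequality along an i.i.d. sequence. -/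
theorem infinitePi_empMean_sub_integral_ge_le [CompleteSpace E] (P : Measure Z)
    [IsProbabilityMeasure P] {F : Z → E} (hF : StronglyMeasurable F) {B : ℝ} (hB0 : 0 < B)
    (hB : ∀ z, ‖F z‖ ≤ B) {n : ℕ} (hn : 0 < n) {ε : ℝ} (hε : 0 ≤ ε) :
    (Measure.infinitePi fun _ : ℕ => P)
        {ω | ε ≤ ‖empMean (fun i : Fin n => ω i) F - ∫ z, F z ∂P‖} ≤
      ENNReal.ofReal (2 * Real.exp (-(n * ε ^ 2 / (8 * B ^ 2)))) := by
  have hmeas : MeasurableSet {T : Fin n → Z | ε ≤ ‖empMean T F - ∫ z, F z ∂P‖} :=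
    measurableSet_le measurable_const (((stronglyMeasurable_sum_pi hF n).const_smul
      (1 / (n : ℝ))).sub stronglyMeasurable_const).norm.measurable
  have h1 := (measurePreserving_infinitePi_fin P n).measure_preimage hmeas.nullMeasurableSet
  have h2 := measure_empMean_sub_integral_ge_le P hF hB0 hB hn hε
  rw [← h1] at h2
  exact h2

end Concentration

/-! ### Algebra of empirical means -/

section EmpiricalMean

variable {Z : Type*} {n : ℕ} {T : Fin n → Z}

theorem empMean_le_add (hn : 0 < n) {F G : Z → ℝ} {c : ℝ} (h : ∀ i, F (T i) ≤ G (T i) + c) :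
    empMean T F ≤ empMean T G + c := by
  have hn' : (0 : ℝ) < n := by exact_mod_cast hn
  have h1 : ∑ i, F (T i) ≤ ∑ i, G (T i) + n * c := by
    have := Finset.sum_le_sum fun i (_ : i ∈ Finset.univ) => h i
    simpa [Finset.sum_add_distrib] using this
  have h2 := mul_le_mul_of_nonneg_left h1 (show 0 ≤ 1 / (n : ℝ) by positivity)
  have h3 : 1 / (n : ℝ) * (∑ i, G (T i) + n * c) = 1 / (n : ℝ) * ∑ i, G (T i) + c := by
    field_simp
  simpa [empMean, h3] using h2.trans_eq h3

theorem empMean_mono {F G : Z → ℝ} (h : ∀ i, F (T i) ≤ G (T i)) : empMean T F ≤ empMean T G :=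
  mul_le_mul_of_nonneg_left (Finset.sum_le_sum fun i _ => h i) (by positivity)

theorem empMean_mul_const (F : Z → ℝ) (c : ℝ) :
    empMean T (fun z => F z * c) = empMean T F * c := by
  simp [empMean, Finset.sum_mul, Finset.mul_sum, mul_assoc]

theorem empMean_const (hn : 0 < n) (c : ℝ) : empMean T (fun _ => c) = c := by
  have hn' : (n : ℝ) ≠ 0 := by exact_mod_cast hn.ne'
  simp [empMean, hn']

theorem inner_empMean {H : Type*} [NormedAddCommGroup H] [InnerProductSpace ℝ H] (F : Z → H)
    (v : H) : inner ℝ (empMean T F) v = empMean T (fun z => inner ℝ (F z) v) := by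
  simp [empMean, inner_smul_left, sum_inner]

theorem empMean_add (F G : Z → ℝ) :
    empMean T (fun z => F z + G z) = empMean T F + empMean T G := by
  simp [empMean, Finset.sum_add_distrib, mul_add]

end EmpiricalMean

/-! ### Stability of regularized risk minimizers -/

section RegularizedRisk

variable {Z : Type*} {H : Type*} [NormedAddCommGroup H] [InnerProductSpace ℝ H]

/-- The margin `⟪Ψ z, g⟫ + α s(z)` of the decision function given by `g` and the offset `α`, where
`Ψ z` is the feature vector multiplied by the label `s z`. -/
noncomputable def margin (Ψ : Z → H) (s : Z → ℝ) (α : ℝ) (g : H) (z : Z) : ℝ :=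
  inner ℝ (Ψ z) g + α * s z

/-- The regularized empirical risk. -/
noncomputable def regEmpRisk (φ : ℝ → ℝ) (Ψ : Z → H) (s : Z → ℝ) (γ : ℝ) {n : ℕ} (T : Fin n → Z)
    (α : ℝ) (g : H) : ℝ :=
  empMean T (fun z => φ (margin Ψ s α g z)) + γ / 2 * ‖g‖ ^ 2

variable {φ φ' : ℝ → ℝ} {L M : ℝ} {Ψ : Z → H} {s : Z → ℝ} {κ γ : ℝ}

theorem abs_margin_le (hΨ : ∀ z, ‖Ψ z‖ ≤ κ) (hs : ∀ z, |s z| ≤ 1) (α : ℝ) (g : H) (z : Z) :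
    |margin Ψ s α g z| ≤ κ * ‖g‖ + |α| := by
  refine (abs_add_le _ _).trans (add_le_add ?_ ?_)
  · exact (abs_real_inner_le_norm _ _).trans (mul_le_mul_of_nonneg_right (hΨ z) (norm_nonneg g))
  · rw [abs_mul]; exact mul_le_of_le_one_right (abs_nonneg α) (hs z)

theorem margin_sub (α α' : ℝ) (g h : H) (z : Z) :
    margin Ψ s α g z - margin Ψ s α' h z = margin Ψ s (α - α') (g - h) z := by
  simp only [margin, inner_sub_right]; ring

theorem stronglyMeasurable_margin [MeasurableSpace Z] (hΨm : StronglyMeasurable Ψ)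
    (hsm : Measurable s) (α : ℝ) (g : H) : StronglyMeasurable (margin Ψ s α g) :=
  (hΨm.inner stronglyMeasurable_const).add (hsm.stronglyMeasurable.const_mul α)

/-- For every fixed offset, the stationarity equation of the regularized risk has a solution. -/
theorem exists_stationary [CompleteSpace H] [MeasurableSpace Z] (hφ : IsMarginLoss φ φ' L M)
    (P : Measure Z) [IsProbabilityMeasure P] (hΨm : StronglyMeasurable Ψ) (hsm : Measurable s)
    (hΨ : ∀ z, ‖Ψ z‖ ≤ κ) (hγ : 0 < γ) (α : ℝ) :
    ∃ h : H, γ • h + ∫ z, φ' (margin Ψ s α h z) • Ψ z ∂P = 0 := by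
  have hκ : 0 ≤ κ := by
    obtain ⟨z⟩ := nonempty_of_isProbabilityMeasure P
    exact (norm_nonneg _).trans (hΨ z)
  have hsmeas : ∀ g, StronglyMeasurable fun z => φ' (margin Ψ s α g z) • Ψ z := fun g =>
    (hφ.continuous'.comp_stronglyMeasurable (stronglyMeasurable_margin hΨm hsm α g)).smul hΨm
  have hbd : ∀ g z, ‖φ' (margin Ψ s α g z) • Ψ z‖ ≤ L * κ := fun g z => by
    rw [norm_smul, Real.norm_eq_abs]
    exact mul_le_mul (hφ.bound _) (hΨ z) (norm_nonneg _) hφ.L_pos.le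
  have hinteg : ∀ g, Integrable (fun z => φ' (margin Ψ s α g z) • Ψ z) P := fun g =>
    Integrable.of_bound (hsmeas g).aestronglyMeasurable _ (ae_of_all _ (hbd g))
  have hmar : ∀ a b z, margin Ψ s α a z - margin Ψ s α b z = inner ℝ (Ψ z) (a - b) :=
    fun a b z => by rw [margin_sub]; simp [margin]
  have hdiff : ∀ a b, (γ • a + ∫ z, φ' (margin Ψ s α a z) • Ψ z ∂P) -
      (γ • b + ∫ z, φ' (margin Ψ s α b z) • Ψ z ∂P) = γ • (a - b) +
        ∫ z, (φ' (margin Ψ s α a z) - φ' (margin Ψ s α b z)) • Ψ z ∂P := fun a b => by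
    simp only [sub_smul]
    rw [integral_sub (hinteg a) (hinteg b), smul_sub]; abel
  have hint2 : ∀ a b,
      Integrable (fun z => (φ' (margin Ψ s α a z) - φ' (margin Ψ s α b z)) • Ψ z) P :=
    fun a b => by simp only [sub_smul]; exact (hinteg a).sub (hinteg b)
  -- The gradient is the sum of `γ • g`, strongly monotone with constant `γ`, and an integral that
  -- is monotone because `φ'` is, and Lipschitz with constant `M κ²`.
  refine exists_zero_of_stronglyMonotone
    (fun g => γ • g + ∫ z, φ' (margin Ψ s α g z) • Ψ z ∂P) (m := γ) (Λ := γ + M * κ * κ) hγ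
    (fun a b => ?_) (fun a b => ?_)
  · rw [hdiff, inner_add_left, inner_smul_left, real_inner_self_eq_norm_sq, real_inner_comm,
      ← integral_inner (hint2 a b)]
    have : 0 ≤ ∫ z, inner ℝ (a - b)
        ((φ' (margin Ψ s α a z) - φ' (margin Ψ s α b z)) • Ψ z) ∂P := by
      refine integral_nonneg fun z => ?_
      simp only [Pi.zero_apply]
      rw [inner_smul_right, real_inner_comm, ← hmar]
      exact hφ.mono _ _
    simpa using this
  · rw [hdiff]
    refine (norm_add_le _ _).trans ?_
    rw [add_mul, norm_smul, Real.norm_of_nonneg hγ.le]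
    gcongr
    have := norm_integral_le_of_norm_le_const (μ := P) (C := M * κ * κ * ‖a - b‖)
      (f := fun z => (φ' (margin Ψ s α a z) - φ' (margin Ψ s α b z)) • Ψ z)
      (ae_of_all _ fun z => ?_)
    · simpa using this
    · rw [norm_smul, Real.norm_eq_abs]
      have h1 := hφ.lip (margin Ψ s α a z) (margin Ψ s α b z)
      rw [hmar] at h1
      have h2 : |inner ℝ (Ψ z) (a - b)| ≤ κ * ‖a - b‖ :=
        (abs_real_inner_le_norm _ _).trans (mul_le_mul_of_nonneg_right (hΨ z) (norm_nonneg _))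
      have h3 := h1.trans (mul_le_mul_of_nonneg_left h2 hφ.M_pos.le)
      calc _ ≤ M * (κ * ‖a - b‖) * κ :=
            mul_le_mul h3 (hΨ z) (norm_nonneg _)
              (mul_nonneg hφ.M_pos.le (mul_nonneg hκ (norm_nonneg _)))
        _ = _ := by ring

/-- Stationarity expresses `γ • h` as minus an average of vectors of norm at most `L * κ`. The
resulting scale `1 / γ` is the source of the factor `γ²` in the rates. -/
theorem norm_stationary_le [MeasurableSpace Z] (hφ : IsMarginLoss φ φ' L M)
    (P : Measure Z) [IsProbabilityMeasure P] (hΨ : ∀ z, ‖Ψ z‖ ≤ κ) (hγ : 0 < γ) {α : ℝ} {h : H}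
    (hst : γ • h + ∫ z, φ' (margin Ψ s α h z) • Ψ z ∂P = 0) : ‖h‖ ≤ L * κ / γ := by
  have h1 := norm_integral_le_of_norm_le_const (μ := P) (C := L * κ)
    (f := fun z => φ' (margin Ψ s α h z) • Ψ z) (ae_of_all _ fun z => by
      rw [norm_smul, Real.norm_eq_abs]
      exact mul_le_mul (hφ.bound _) (hΨ z) (norm_nonneg _) hφ.L_pos.le)
  have h2 : ‖γ • h‖ ≤ L * κ := by
    rw [eq_neg_of_add_eq_zero_left hst, norm_neg]; simpa using h1
  rw [norm_smul, Real.norm_of_nonneg hγ.le] at h2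
  rw [le_div_iff₀ hγ]; linarith

/-- A near minimizer of the regularized empirical risk at the offset `α` is close to the stationary
point of the regularized risk at `α`. -/
theorem sq_norm_sub_stationary_le [MeasurableSpace Z] (hφ : IsMarginLoss φ φ' L M)
    (P : Measure Z) (hγ : 0 < γ) {α : ℝ} {h g : H}
    (hst : γ • h + ∫ z, φ' (margin Ψ s α h z) • Ψ z ∂P = 0) {n : ℕ} {T : Fin n → Z} {η : ℝ}
    (hdev : ‖empMean T (fun z => φ' (margin Ψ s α h z) • Ψ z) -
      ∫ z, φ' (margin Ψ s α h z) • Ψ z ∂P‖ ≤ γ * η)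
    (hmin : regEmpRisk φ Ψ s γ T α g ≤ regEmpRisk φ Ψ s γ T α h + L * (γ * η)) :
    ‖g - h‖ ^ 2 ≤ 2 * η * ‖g - h‖ + 2 * L * η := by
  set I := ∫ z, φ' (margin Ψ s α h z) • Ψ z ∂P
  set D := empMean T (fun z => φ' (margin Ψ s α h z) • Ψ z)
  have h1 : empMean T (fun z => φ (margin Ψ s α h z)) + inner ℝ D (g - h) ≤
      empMean T (fun z => φ (margin Ψ s α g z)) := by
    rw [inner_empMean, ← empMean_add]
    refine empMean_mono fun i => ?_
    have := hφ.tangent (margin Ψ s α h (T i)) (margin Ψ s α g (T i))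
    rw [margin_sub] at this
    simpa [margin, inner_smul_left] using this
  have h2 : inner ℝ D (g - h) = inner ℝ (D - I) (g - h) - γ * inner ℝ h (g - h) := by
    have hI : I = -(γ • h) := eq_neg_of_add_eq_zero_right hst
    rw [inner_sub_left, hI, inner_neg_left, inner_smul_left]; simp
  have h3 : -(γ * η * ‖g - h‖) ≤ inner ℝ (D - I) (g - h) := by
    have := (abs_le.mp (abs_real_inner_le_norm (D - I) (g - h))).1
    have := mul_le_mul_of_nonneg_right hdev (norm_nonneg (g - h))
    linarith
  have h4 : ‖g‖ ^ 2 = ‖h‖ ^ 2 + 2 * inner ℝ h (g - h) + ‖g - h‖ ^ 2 := by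
    rw [← norm_add_sq_real, add_sub_cancel]
  simp only [regEmpRisk] at hmin
  rw [h4] at hmin
  -- Since the mean gradient is `-(γ • h)`, its contribution cancels the cross term in the expansion
  -- of `γ / 2 * ‖g‖ ^ 2` around `h`; what survives is the quadratic term against the two error
  -- terms.
  have h5 : γ * ‖g - h‖ ^ 2 ≤ γ * (2 * η * ‖g - h‖ + 2 * L * η) := by nlinarith
  exact le_of_mul_le_mul_left h5 hγ

/-- The risk of a regularized empirical risk minimizer `(α, g)` in terms of that of a competitor
`g₀`, on the event that three empirical means are close to their expectations. -/
theorem risk_le_of_deviations [MeasurableSpace Z] (hφ : IsMarginLoss φ φ' L M)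
    (P : Measure Z) [IsProbabilityMeasure P] (hΨm : StronglyMeasurable Ψ) (hsm : Measurable s)
    (hΨ : ∀ z, ‖Ψ z‖ ≤ κ) (hs : ∀ z, |s z| ≤ 1) (hγ : 0 < γ) (hγ1 : γ ≤ 1) {α α' : ℝ} {h g g₀ : H}
    (hst : γ • h + ∫ z, φ' (margin Ψ s α' h z) • Ψ z ∂P = 0) {n : ℕ} (hn : 0 < n) {T : Fin n → Z}
    {η δ τ : ℝ} (hη : 0 ≤ η) (hτ : 0 < τ) (hητ : 4 * η ≤ τ) (hητ2 : 4 * L * η ≤ τ ^ 2)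
    (hα : |α - α'| ≤ γ * η)
    (hdev : ‖empMean T (fun z => φ' (margin Ψ s α' h z) • Ψ z) -
      ∫ z, φ' (margin Ψ s α' h z) • Ψ z ∂P‖ ≤ γ * η)
    (hdev' : |empMean T (fun z => φ (margin Ψ s α' h z)) - ∫ z, φ (margin Ψ s α' h z) ∂P| ≤ δ)
    (hdev₀ : |empMean T (fun z => φ (margin Ψ s 0 g₀ z)) - ∫ z, φ (margin Ψ s 0 g₀ z) ∂P| ≤ δ)
    (hreg : γ / 2 * ‖g₀‖ ^ 2 ≤ δ)
    (hmin : regEmpRisk φ Ψ s γ T α g ≤ regEmpRisk φ Ψ s γ T α' h)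
    (hmin₀ : regEmpRisk φ Ψ s γ T α g ≤ regEmpRisk φ Ψ s γ T 0 g₀) :
    ∫ z, φ (margin Ψ s α g z) ∂P ≤
      ∫ z, φ (margin Ψ s 0 g₀ z) ∂P + (3 * δ + 2 * L * (κ * τ + η)) := by
  have hκ : 0 ≤ κ := by
    obtain ⟨z⟩ := nonempty_of_isProbabilityMeasure P
    exact (norm_nonneg _).trans (hΨ z)
  have hL := hφ.L_pos
  have hinteg : ∀ a g, Integrable (fun z => φ (margin Ψ s a g z)) P := fun a g => by
    refine Integrable.of_bound (C := 1 + L * (κ * ‖g‖ + |a|)) (hφ.continuous.comp_stronglyMeasurable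
      (stronglyMeasurable_margin hΨm hsm a g)).aestronglyMeasurable (ae_of_all _ fun z => ?_)
    rw [Real.norm_of_nonneg (hφ.nonneg _)]
    refine (hφ.le_one_add _).trans ?_
    gcongr
    exact abs_margin_le hΨ hs a g z
  have hγη : γ * η ≤ η := mul_le_of_le_one_left hη hγ1
  -- Moving the offset from `α` to `α'` changes each loss by at most `L * (γ * η)`, so `g` nearly
  -- minimizes at the offset `α'` for which `h` is stationary.
  have hnear : regEmpRisk φ Ψ s γ T α' g ≤ regEmpRisk φ Ψ s γ T α' h + L * (γ * η) := by
    refine le_trans ?_ (add_le_add_left hmin _)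
    have : empMean T (fun z => φ (margin Ψ s α' g z)) ≤
        empMean T (fun z => φ (margin Ψ s α g z)) + L * (γ * η) := by
      refine empMean_le_add hn fun i => ?_
      have h1 := hφ.sub_le (margin Ψ s α' g (T i)) (margin Ψ s α g (T i))
      rw [margin_sub, sub_self] at h1
      have h2 := abs_margin_le hΨ hs (α' - α) (0 : H) (T i)
      rw [abs_sub_comm α' α, norm_zero, mul_zero, zero_add] at h2
      have h3 := mul_le_mul_of_nonneg_left (h2.trans hα) hL.le
      linarith
    simp only [regEmpRisk]; linarith
  have hsq := sq_norm_sub_stationary_le hφ P hγ hst hdev hnear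
  -- Were `‖g - h‖ > τ`, the terms `2 * η * ‖g - h‖` and `2 * L * η` would be at most `τ * ‖g - h‖ /
  -- 2` and `τ ^ 2 / 2`, with sum below `‖g - h‖ ^ 2`.
  have hclose : ‖g - h‖ ≤ τ := by
    by_contra hcon
    push Not at hcon
    have h1 : τ ^ 2 < ‖g - h‖ ^ 2 := by gcongr
    nlinarith
  have hmar : ∀ z, |margin Ψ s α g z - margin Ψ s α' h z| ≤ κ * τ + η := fun z => by
    rw [margin_sub]
    refine (abs_margin_le hΨ hs _ _ z).trans ?_
    have := mul_le_mul_of_nonneg_left hclose hκ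
    linarith
  have h1 : ∫ z, φ (margin Ψ s α g z) ∂P ≤
      ∫ z, φ (margin Ψ s α' h z) ∂P + L * (κ * τ + η) := by
    have := integral_mono (hinteg α g) ((hinteg α' h).add (integrable_const (L * (κ * τ + η))))
      (fun z => by
        have h1 := hφ.sub_le (margin Ψ s α g z) (margin Ψ s α' h z)
        have h2 := mul_le_mul_of_nonneg_left (hmar z) hL.le
        simp only [Pi.add_apply]
        linarith)
    rw [integral_add' (hinteg α' h) (integrable_const _)] at this
    simpa using this
  have h2 : empMean T (fun z => φ (margin Ψ s α' h z)) ≤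
      empMean T (fun z => φ (margin Ψ s α g z)) + L * (κ * τ + η) := by
    refine empMean_le_add hn fun i => ?_
    have h1 := hφ.sub_le (margin Ψ s α' h (T i)) (margin Ψ s α g (T i))
    have h2 := mul_le_mul_of_nonneg_left (hmar (T i)) hL.le
    rw [abs_sub_comm] at h1
    linarith
  have h3 : empMean T (fun z => φ (margin Ψ s α g z)) ≤ regEmpRisk φ Ψ s γ T α g := by
    simp only [regEmpRisk]
    have : 0 ≤ γ / 2 * ‖g‖ ^ 2 := by positivity
    linarith
  have h4 : regEmpRisk φ Ψ s γ T 0 g₀ ≤ ∫ z, φ (margin Ψ s 0 g₀ z) ∂P + 2 * δ := by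
    simp only [regEmpRisk]
    linarith [(abs_le.mp hdev₀).2]
  linarith [(abs_le.mp hdev').1]

/-- The offset of a pair whose regularized empirical risk is at most `1` is bounded in terms of the
frequency of the label `y`. -/
theorem neg_mul_offset_le (hφ : IsMarginLoss φ φ' L M) (hΨ : ∀ z, ‖Ψ z‖ ≤ κ)
    (hs : ∀ z, s z = 1 ∨ s z = -1) (hγ : 0 ≤ γ) {n : ℕ} {T : Fin n → Z} {α : ℝ} {g : H}
    (hle : regEmpRisk φ Ψ s γ T α g ≤ 1) {y p : ℝ} (hy : y = 1 ∨ y = -1) (hp : 0 < p)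
    (hfreq : p ≤ empMean T (fun z => (1 + y * s z) / 2)) :
    -(y * α) ≤ κ * ‖g‖ + 1 / (-φ' 0 * p) := by
  have hc : 0 < -φ' 0 := by linarith [hφ.neg]
  have hcp : 0 < -φ' 0 * p := mul_pos hc hp
  by_contra hcon
  push Not at hcon
  -- Every example labelled `y` has margin at most `-b`, hence loss at least `-φ' 0 * b` by the
  -- tangent at `0`. As `(1 + y * s z) / 2` is the indicator of that label, a large `b` forces the
  -- mean loss above `1`.
  set b := -(y * α) - κ * ‖g‖ with hb
  have hb0 : 1 / (-φ' 0 * p) < b := by linarith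
  have hb1 : 0 < b := lt_trans (by positivity) hb0
  have h1 : empMean T (fun z => (1 + y * s z) / 2 * (-φ' 0 * b)) ≤
      empMean T (fun z => φ (margin Ψ s α g z)) := by
    refine empMean_mono fun i => ?_
    by_cases hsy : s (T i) = y
    · have hyy : (1 + y * s (T i)) / 2 = 1 := by
        rw [hsy]; rcases hy with h | h <;> rw [h] <;> norm_num
      have h2 := hφ.tangent 0 (margin Ψ s α g (T i))
      rw [hφ.zero, sub_zero] at h2
      have h3 : margin Ψ s α g (T i) ≤ -b := by
        have := (le_abs_self _).trans ((abs_real_inner_le_norm (Ψ (T i)) g).trans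
          (mul_le_mul_of_nonneg_right (hΨ (T i)) (norm_nonneg g)))
        simp only [margin, hsy, hb]; linarith
      rw [hyy, one_mul]
      nlinarith
    · have hyy : (1 + y * s (T i)) / 2 = 0 := by
        rcases hy with h | h <;> rcases hs (T i) with h' | h' <;> rw [h, h'] <;>
          first | exact absurd (h'.trans h.symm) hsy | norm_num
      rw [hyy, zero_mul]
      exact hφ.nonneg _
  rw [empMean_mul_const] at h1
  have h2 : empMean T (fun z => φ (margin Ψ s α g z)) ≤ 1 := by
    simp only [regEmpRisk] at hle
    have : 0 ≤ γ / 2 * ‖g‖ ^ 2 := by positivity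
    linarith
  have h3 := mul_le_mul_of_nonneg_right hfreq (mul_pos hc hb1).le
  rw [div_lt_iff₀ hcp] at hb0
  nlinarith

theorem regEmpRisk_zero (hφ : IsMarginLoss φ φ' L M) {n : ℕ} (hn : 0 < n) (T : Fin n → Z) :
    regEmpRisk φ Ψ s γ T 0 0 = 1 := by
  simp [regEmpRisk, margin, hφ.zero, empMean_const hn]

theorem mul_sq_norm_le_two (hφ : IsMarginLoss φ φ' L M) {n : ℕ} {T : Fin n → Z} {α : ℝ} {g : H}
    (hle : regEmpRisk φ Ψ s γ T α g ≤ 1) : γ * ‖g‖ ^ 2 ≤ 2 := by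
  have : 0 ≤ empMean T (fun z => φ (margin Ψ s α g z)) :=
    mul_nonneg (by positivity) (Finset.sum_nonneg fun i _ => hφ.nonneg _)
  simp only [regEmpRisk] at hle
  linarith

end RegularizedRisk

/-! ### The two labels -/

/-- Required for the conditional distribution `P.condKernel` of the label given the point. -/
instance : StandardBorelSpace Label :=
  MeasurableSet.standardBorel (Set.Finite.measurableSet (by simp))

/-- The label `1`. -/
def posLabel : Label := ⟨1, by simp⟩

/-- The label `-1`. -/
def negLabel : Label := ⟨-1, by simp⟩

theorem label_eq (y : Label) : y = posLabel ∨ y = negLabel := by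
  obtain ⟨y, hy⟩ := y
  rcases hy with h | h
  · left; exact Subtype.ext h
  · right; exact Subtype.ext h

theorem posLabel_ne_negLabel : posLabel ≠ negLabel := by
  intro h
  have := congrArg Subtype.val h
  simp only [posLabel, negLabel] at this
  norm_num at this

instance : Nonempty Label := ⟨posLabel⟩

instance : Finite Label := Set.Finite.to_subtype (by simp)

theorem label_coe (y : Label) : (y : ℝ) = 1 ∨ (y : ℝ) = -1 := by
  rcases label_eq y with h | h <;> rw [h]
  · left; rfl
  · right; rfl

theorem abs_label_coe (y : Label) : |(y : ℝ)| = 1 := by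
  rcases label_coe y with h | h <;> rw [h] <;> norm_num

/-! ### Calibration: from excess risk to excess classification error -/

section Calibration

variable {𝓧 : Type*} [MeasurableSpace 𝓧]

theorem integral_label (ν : Measure Label) [IsProbabilityMeasure ν] (F : Label → ℝ) :
    ∫ y, F y ∂ν = ν.real {posLabel} * F posLabel + (1 - ν.real {posLabel}) * F negLabel := by
  classical
  let : Fintype Label := Fintype.ofFinite _
  have huniv : (Finset.univ : Finset Label) = {posLabel, negLabel} := by
    ext y; simpa using label_eq y
  have hcompl : ({posLabel}ᶜ : Set Label) = {negLabel} := by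
    ext y
    rcases label_eq y with h | h <;> rw [h] <;>
      simp [posLabel_ne_negLabel, posLabel_ne_negLabel.symm]
  have h1 : ν.real {negLabel} = 1 - ν.real {posLabel} := by
    rw [← hcompl, probReal_compl_eq_one_sub (measurableSet_singleton _)]
  rw [integral_fintype (Integrable.of_finite), huniv, Finset.sum_pair posLabel_ne_negLabel, h1]
  simp

/-- Disintegration of the distribution of a labelled point by the regression function `η`. -/
theorem exists_regression (P : Measure (𝓧 × Label)) [IsProbabilityMeasure P] :
    ∃ η : 𝓧 → ℝ, Measurable η ∧ (∀ x, 0 ≤ η x) ∧ (∀ x, η x ≤ 1) ∧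
      ∀ F : 𝓧 × Label → ℝ, Integrable F P →
        ∫ z, F z ∂P = ∫ x, (η x * F (x, posLabel) + (1 - η x) * F (x, negLabel)) ∂P.fst := by
  refine ⟨fun x => (P.condKernel x).real {posLabel}, ?_, fun x => measureReal_nonneg,
    fun x => measureReal_le_one, fun F hF => ?_⟩
  · exact (ProbabilityTheory.Kernel.measurable_coe _ (measurableSet_singleton _)).ennreal_toReal
  · rw [← Measure.integral_condKernel hF]
    exact integral_congr_ae (ae_of_all _ fun x => integral_label _ _)

/-- The risk of the decision function `f` for the margin loss `φ`. -/
noncomputable def marginRisk (φ : ℝ → ℝ) (P : Measure (𝓧 × Label)) (f : 𝓧 → ℝ) : ℝ :=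
  ∫ z, φ ((z.2 : ℝ) * f z.1) ∂P

variable {φ φ' : ℝ → ℝ} {L M : ℝ}

theorem measurable_label_coe : Measurable fun z : 𝓧 × Label => (z.2 : ℝ) :=
  measurable_subtype_coe.comp measurable_snd

theorem measurable_label_mul {f : 𝓧 → ℝ} (hf : Measurable f) :
    Measurable fun z : 𝓧 × Label => (z.2 : ℝ) * f z.1 :=
  measurable_label_coe.mul (hf.comp measurable_fst)

theorem integrable_marginLoss (hφ : IsMarginLoss φ φ' L M) (P : Measure (𝓧 × Label))
    [IsProbabilityMeasure P] {f : 𝓧 → ℝ} (hf : Measurable f) {b : ℝ} (hb : ∀ x, |f x| ≤ b) :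
    Integrable (fun z : 𝓧 × Label => φ ((z.2 : ℝ) * f z.1)) P := by
  refine Integrable.of_bound (C := 1 + L * b)
    (hφ.continuous.measurable.comp (measurable_label_mul hf)).aestronglyMeasurable
    (ae_of_all _ fun z => ?_)
  rw [Real.norm_of_nonneg (hφ.nonneg _)]
  refine (hφ.le_one_add _).trans ?_
  rw [abs_mul, abs_label_coe, one_mul]
  have := mul_le_mul_of_nonneg_left (hb z.1) hφ.L_pos.le
  linarith

/-- A prediction `t` of the wrong sign has conditional risk at least `1`, by the tangent at `0`. The
quadratic upper bound `1 + φ' 0 * (2 * η - 1) * u + M * u ^ 2` is minimized at the displayed point,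
where it falls below `1` by exactly the displayed gap. -/
theorem conditional_risk_gap (hφ : IsMarginLoss φ φ' L M) {η t : ℝ} (h0 : 0 ≤ η) (h1 : η ≤ 1)
    (hw : (2 * η - 1) * t ≤ 0) :
    η * φ (-φ' 0 / (2 * M) * (2 * η - 1)) + (1 - η) * φ (-(-φ' 0 / (2 * M) * (2 * η - 1))) +
      φ' 0 ^ 2 / (4 * M) * (2 * η - 1) ^ 2 ≤ η * φ t + (1 - η) * φ (-t) := by
  set u := -φ' 0 / (2 * M) * (2 * η - 1) with hu
  have q1 := mul_le_mul_of_nonneg_left (hφ.quadratic 0 u) h0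
  have q2 := mul_le_mul_of_nonneg_left (hφ.quadratic 0 (-u)) (sub_nonneg.mpr h1)
  have t1 := mul_le_mul_of_nonneg_left (hφ.tangent 0 t) h0
  have t2 := mul_le_mul_of_nonneg_left (hφ.tangent 0 (-t)) (sub_nonneg.mpr h1)
  rw [hφ.zero] at q1 q2 t1 t2
  have hM := hφ.M_pos
  have e : φ' 0 * (2 * η - 1) * u + M * u ^ 2 + φ' 0 ^ 2 / (4 * M) * (2 * η - 1) ^ 2 = 0 := by
    rw [hu]; field_simp; ring
  have hneg := hφ.neg
  have h3 : 0 ≤ φ' 0 * ((2 * η - 1) * t) := mul_nonneg_of_nonpos_of_nonpos hneg.le hw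
  nlinarith

theorem sq_integral_le {μ : Measure 𝓧} [IsProbabilityMeasure μ] {u : 𝓧 → ℝ} (hu : Integrable u μ)
    (hu2 : Integrable (fun x => u x ^ 2) μ) : (∫ x, u x ∂μ) ^ 2 ≤ ∫ x, u x ^ 2 ∂μ := by
  set m := ∫ x, u x ∂μ with hm
  have h : ∫ x, (2 * m * u x - m ^ 2) ∂μ ≤ ∫ x, u x ^ 2 ∂μ :=
    integral_mono ((hu.const_mul _).sub (integrable_const _)) hu2
      fun x => by nlinarith [sq_nonneg (u x - m)]
  rw [integral_sub (hu.const_mul _) (integrable_const _), integral_const_mul, ← hm] at h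
  simp at h
  nlinarith

theorem generalizationError_eq_integral (P : Measure (𝓧 × Label)) [IsProbabilityMeasure P]
    {η : 𝓧 → ℝ} (hη : ∀ F : 𝓧 × Label → ℝ, Integrable F P →
      ∫ z, F z ∂P = ∫ x, (η x * F (x, posLabel) + (1 - η x) * F (x, negLabel)) ∂P.fst)
    {f : 𝓧 → ℝ} (hf : Measurable f) :
    generalizationError P f = ∫ x, (if f x ≤ 0 then η x else 1 - η x) ∂P.fst := by
  set S : Set (𝓧 × Label) :=
    {z | ((z.2 : ℝ) = 1 ∧ f z.1 ≤ 0) ∨ ((z.2 : ℝ) = -1 ∧ 0 < f z.1)} with hS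
  have hSm : MeasurableSet S := by
    have hf' : Measurable fun z : 𝓧 × Label => f z.1 := hf.comp measurable_fst
    exact ((measurableSet_eq_fun measurable_label_coe measurable_const).inter
      (measurableSet_le hf' measurable_const)).union
      ((measurableSet_eq_fun measurable_label_coe measurable_const).inter
      (measurableSet_lt measurable_const hf'))
  have h1 : generalizationError P f = ∫ z, S.indicator (fun _ => (1 : ℝ)) z ∂P := by
    exact (integral_indicator_one hSm).symm
  rw [h1, hη _ ((integrable_const _).indicator hSm)]
  refine integral_congr_ae (ae_of_all _ fun x => ?_)
  have e1 : ((posLabel : Label) : ℝ) = 1 := rfl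
  have e2 : ((negLabel : Label) : ℝ) = -1 := rfl
  by_cases hx : f x ≤ 0
  · have m1 : (x, posLabel) ∈ S := Or.inl ⟨rfl, hx⟩
    have m2 : (x, negLabel) ∉ S := by
      rintro (h | h)
      · have := h.1; simp only [e2] at this; norm_num at this
      · exact absurd h.2 (not_lt.mpr hx)
    simp [hx, m1, m2]
  · have m1 : (x, posLabel) ∉ S := by
      rintro (h | h)
      · exact hx h.2
      · have := h.1; simp only [e1] at this; norm_num at this
    have m2 : (x, negLabel) ∈ S := Or.inr ⟨rfl, not_le.mp hx⟩
    simp [hx, m1, m2]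

theorem bayesError_le (P : Measure (𝓧 × Label)) {f : 𝓧 → ℝ} (hf : Measurable f) :
    bayesError P ≤ generalizationError P f :=
  ciInf_le ⟨0, by rintro _ ⟨f, rfl⟩; exact measureReal_nonneg⟩
    (⟨f, hf⟩ : {f : 𝓧 → ℝ // Measurable f})

/-- The excess generalization error is controlled by the excess risk over a bounded function. -/
theorem exists_sq_excess_le (hφ : IsMarginLoss φ φ' L M) (P : Measure (𝓧 × Label))
    [IsProbabilityMeasure P] {f : 𝓧 → ℝ} (hf : Measurable f) {b : ℝ} (hb : ∀ x, |f x| ≤ b) :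
    ∃ f₁ : 𝓧 → ℝ, Measurable f₁ ∧ (∃ b₁, ∀ x, |f₁ x| ≤ b₁) ∧
      φ' 0 ^ 2 / (4 * M) * (generalizationError P f - bayesError P) ^ 2 ≤
        marginRisk φ P f - marginRisk φ P f₁ := by
  obtain ⟨η, hηm, hη0, hη1, hη⟩ := exists_regression P
  set c := φ' 0 ^ 2 / (4 * M) with hc
  have hM := hφ.M_pos
  have hc0 : 0 ≤ c := by positivity
  -- Off `W` the decision `f` agrees with the Bayes rule. The comparison function `f₁` changes `f`
  -- only on `W`, to the bounded predictor `r` of `conditional_risk_gap`; a minimizer of the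
  -- conditional risk, which need not exist where `η` is `0` or `1`, is never used.
  set W : Set 𝓧 := {x | (2 * η x - 1) * f x ≤ 0} with hW
  have hWm : MeasurableSet W :=
    measurableSet_le (((hηm.const_mul 2).sub_const 1).mul hf) measurable_const
  classical
  set r : 𝓧 → ℝ := fun x => -φ' 0 / (2 * M) * (2 * η x - 1) with hr
  have hrm : Measurable r := ((hηm.const_mul 2).sub_const 1).const_mul _
  have hrb : ∀ x, |r x| ≤ -φ' 0 / (2 * M) := fun x => by
    have hp : 0 ≤ -φ' 0 / (2 * M) := div_nonneg (by linarith [hφ.neg]) (by positivity)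
    rw [hr, abs_mul, abs_of_nonneg hp]
    refine mul_le_of_le_one_right hp (abs_le.mpr ⟨?_, ?_⟩) <;> linarith [hη0 x, hη1 x]
  set f₁ : 𝓧 → ℝ := W.piecewise r f with hf₁
  have hf₁m : Measurable f₁ := hrm.piecewise hWm hf
  have hf₁b : ∀ x, |f₁ x| ≤ max (-φ' 0 / (2 * M)) b := fun x => by
    by_cases hx : x ∈ W
    · rw [hf₁, Set.piecewise_eq_of_mem _ _ _ hx]; exact (hrb x).trans (le_max_left _ _)
    · rw [hf₁, Set.piecewise_eq_of_notMem _ _ _ hx]; exact (hb x).trans (le_max_right _ _)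
  refine ⟨f₁, hf₁m, ⟨_, hf₁b⟩, ?_⟩
  -- Pointwise, `u` bounds the excess classification error and `c * u ^ 2` bounds the excess risk
  -- from below; Jensen's inequality links the two integrals.
  set u : 𝓧 → ℝ := W.indicator fun x => |2 * η x - 1| with hu
  have hum : Measurable u := (((hηm.const_mul 2).sub_const 1).abs).indicator hWm
  have hub : ∀ x, ‖u x‖ ≤ 1 := fun x => by
    by_cases hx : x ∈ W
    · rw [hu, Set.indicator_of_mem hx, Real.norm_eq_abs, abs_abs, abs_le]
      constructor <;> linarith [hη0 x, hη1 x]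
    · rw [hu, Set.indicator_of_notMem hx]; simp
  have hui : Integrable u P.fst :=
    Integrable.of_bound hum.aestronglyMeasurable 1 (ae_of_all _ hub)
  have hu2i : Integrable (fun x => u x ^ 2) P.fst := by
    refine Integrable.of_bound (hum.pow_const 2).aestronglyMeasurable 1 (ae_of_all _ fun x => ?_)
    rw [norm_pow]; exact pow_le_one₀ (norm_nonneg _) (hub x)
  have hcond : ∀ (f : 𝓧 → ℝ), Measurable f → ∀ b, (∀ x, |f x| ≤ b) →
      marginRisk φ P f = ∫ x, (η x * φ (f x) + (1 - η x) * φ (-f x)) ∂P.fst ∧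
      Integrable (fun x => η x * φ (f x) + (1 - η x) * φ (-f x)) P.fst := fun f hf b hb => by
    constructor
    · rw [marginRisk, hη _ (integrable_marginLoss hφ P hf hb)]
      simp [posLabel, negLabel]
    · have hφb : ∀ t x, |t| = |f x| → |φ t| ≤ 1 + L * b := fun t x ht => by
        rw [abs_of_nonneg (hφ.nonneg t)]
        have := mul_le_mul_of_nonneg_left (ht.trans_le (hb x)) hφ.L_pos.le
        linarith [hφ.le_one_add t]
      refine Integrable.of_bound (C := (1 + L * b) + (1 + L * b)) ?_ (ae_of_all _ fun x => ?_)
      · exact ((hηm.mul (hφ.continuous.measurable.comp hf)).add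
          ((measurable_const.sub hηm).mul
            (hφ.continuous.measurable.comp hf.neg))).aestronglyMeasurable
      · refine (norm_add_le _ _).trans (add_le_add ?_ ?_) <;>
          rw [Real.norm_eq_abs, abs_mul]
        · rw [abs_of_nonneg (hη0 x)]
          exact (mul_le_of_le_one_left (abs_nonneg _) (hη1 x)).trans (hφb _ x rfl)
        · rw [abs_of_nonneg (sub_nonneg.mpr (hη1 x))]
          exact (mul_le_of_le_one_left (abs_nonneg _) (by linarith [hη0 x])).trans
            (hφb _ x (abs_neg _))
  obtain ⟨hRf, hRfi⟩ := hcond f hf b hb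
  obtain ⟨hRf₁, hRf₁i⟩ := hcond f₁ hf₁m _ hf₁b
  have hrisk : c * ∫ x, u x ^ 2 ∂P.fst ≤ marginRisk φ P f - marginRisk φ P f₁ := by
    rw [hRf, hRf₁, ← integral_sub hRfi hRf₁i, ← integral_const_mul]
    refine integral_mono (hu2i.const_mul c) (hRfi.sub hRf₁i) fun x => ?_
    by_cases hx : x ∈ W
    · have := conditional_risk_gap hφ (hη0 x) (hη1 x) hx
      simp only [hf₁, Set.piecewise_eq_of_mem _ _ _ hx, hu, Set.indicator_of_mem hx, sq_abs, hr]
      linarith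
    · simp [hf₁, Set.piecewise_eq_of_notMem _ _ _ hx, hu, Set.indicator_of_notMem hx]
  have hmini : Integrable (fun x => min (η x) (1 - η x)) P.fst := by
    refine Integrable.of_bound (hηm.min (measurable_const.sub hηm)).aestronglyMeasurable 1
      (ae_of_all _ fun x => ?_)
    rw [Real.norm_of_nonneg (le_min (hη0 x) (by linarith [hη1 x]))]
    exact (min_le_left _ _).trans (hη1 x)
  have hitei : ∀ h : 𝓧 → ℝ, Measurable h →
      Integrable (fun x => if h x ≤ 0 then η x else 1 - η x) P.fst := fun h hh => by
    refine Integrable.of_bound (Measurable.ite (measurableSet_le hh measurable_const) hηm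
      (measurable_const.sub hηm)).aestronglyMeasurable 1 (ae_of_all _ fun x => ?_)
    split_ifs
    · rw [Real.norm_of_nonneg (hη0 x)]; exact hη1 x
    · rw [Real.norm_of_nonneg (by linarith [hη1 x])]; linarith [hη0 x]
  have hbayes : ∫ x, min (η x) (1 - η x) ∂P.fst ≤ bayesError P := by
    have : Nonempty {f : 𝓧 → ℝ // Measurable f} := ⟨⟨f, hf⟩⟩
    refine le_ciInf fun h => ?_
    rw [generalizationError_eq_integral P hη h.2]
    refine integral_mono hmini (hitei h h.2) fun x => ?_
    simp only
    split_ifs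
    · exact min_le_left _ _
    · exact min_le_right _ _
  have herr : generalizationError P f - bayesError P ≤ ∫ x, u x ∂P.fst := by
    refine (sub_le_sub_left hbayes _).trans ?_
    rw [generalizationError_eq_integral P hη hf, ← integral_sub (hitei f hf) hmini]
    refine integral_mono ((hitei f hf).sub hmini) hui fun x => ?_
    by_cases hx : x ∈ W
    · simp only [hu, Set.indicator_of_mem hx]
      have h1 := le_abs_self (2 * η x - 1)
      have h2 := neg_abs_le (2 * η x - 1)
      split_ifs <;> rcases min_choice (η x) (1 - η x) with h | h <;> rw [h] <;>
        linarith [abs_nonneg (2 * η x - 1)]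
    · have hx' : 0 < (2 * η x - 1) * f x := not_le.mp hx
      simp only [hu, Set.indicator_of_notMem hx]
      split_ifs with h
      · have : 2 * η x - 1 < 0 := by
          by_contra hcon
          exact absurd (mul_nonpos_of_nonneg_of_nonpos (not_lt.mp hcon) h) (not_le.mpr hx')
        rw [min_eq_left (by linarith)]; linarith
      · have : 0 < 2 * η x - 1 := (pos_iff_pos_of_mul_pos hx').mpr (not_le.mp h)
        rw [min_eq_right (by linarith)]; linarith
  calc c * (generalizationError P f - bayesError P) ^ 2
      ≤ c * (∫ x, u x ∂P.fst) ^ 2 := by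
        gcongr
        exact sub_nonneg.mpr (bayesError_le P hf)
    _ ≤ c * ∫ x, u x ^ 2 ∂P.fst := by
        gcongr
        exact sq_integral_le hui hu2i
    _ ≤ _ := hrisk

/-- If a class of continuous functions is uniformly dense, then it contains a competitor such that
all functions of nearly smaller risk have nearly minimal generalization error. -/
theorem exists_competitor [TopologicalSpace 𝓧] [T2Space 𝓧] [CompactSpace 𝓧]
    [SecondCountableTopology 𝓧] [BorelSpace 𝓧]
    (hφ : IsMarginLoss φ φ' L M) (P : Measure (𝓧 × Label)) [IsProbabilityMeasure P]
    {ι : Type*} (G : ι → 𝓧 → ℝ) (hG : ∀ i, Continuous (G i))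
    (hdense : ∀ u : C(𝓧, ℝ), ∀ ε > 0, ∃ i, ∀ x, |u x - G i x| ≤ ε) {ε : ℝ} (hε : 0 < ε) :
    ∃ i, ∃ δ > 0, ∀ f : 𝓧 → ℝ, Measurable f → (∃ b, ∀ x, |f x| ≤ b) →
      marginRisk φ P f ≤ marginRisk φ P (G i) + δ →
        generalizationError P f ≤ bayesError P + ε := by
  set S : Set ℝ := {t | ∃ f : 𝓧 → ℝ, Measurable f ∧ (∃ b, ∀ x, |f x| ≤ b) ∧ marginRisk φ P f = t}
    with hS
  have hSbdd : BddBelow S := ⟨0, by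
    rintro _ ⟨f, -, -, rfl⟩
    exact integral_nonneg fun z => hφ.nonneg _⟩
  have hSne : S.Nonempty := ⟨_, fun _ => 0, measurable_const, ⟨0, by simp⟩, rfl⟩
  set c := φ' 0 ^ 2 / (4 * M) with hc
  have hM := hφ.M_pos
  have hc0 : 0 < c := div_pos (sq_pos_of_neg hφ.neg) (by positivity)
  -- Three errors of size `δ` accumulate: `f₁` against the infimum, `G i` against `f₁`, and `f`
  -- against `G i`. Their sum stays below `c * ε ^ 2`.
  set δ := c * ε ^ 2 / 4 with hδ
  have hδ0 : 0 < δ := by positivity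
  obtain ⟨_, ⟨f₁, hf₁m, ⟨b₁, hf₁b⟩, rfl⟩, hf₁⟩ := exists_lt_of_csInf_lt hSne
    (show sInf S < sInf S + δ by linarith)
  have hL := hφ.L_pos
  -- Spent twice: on approximating `f₁` in `L¹` by a continuous `u`, and on approximating `u`
  -- uniformly by `G i`. The loss is `L`-Lipschitz, so the total is `δ`.
  set τ := δ / (2 * L) with hτ
  have hτ0 : 0 < τ := by positivity
  obtain ⟨u, hu, hui⟩ := Integrable.exists_boundedContinuous_integral_sub_le (μ := P.fst) (f := f₁)
    (Integrable.of_bound hf₁m.aestronglyMeasurable b₁ (ae_of_all _ hf₁b)) hτ0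
  obtain ⟨i, hi⟩ := hdense u.toContinuousMap τ hτ0
  have hGb : ∃ b, ∀ x, |G i x| ≤ b := by
    obtain ⟨b, hb⟩ := isCompact_univ.exists_bound_of_continuousOn (hG i).continuousOn
    exact ⟨b, fun x => hb x trivial⟩
  obtain ⟨b, hb⟩ := hGb
  have hGm : Measurable (G i) := (hG i).measurable
  have hcompare : marginRisk φ P (G i) ≤ marginRisk φ P f₁ + δ := by
    have hdi : Integrable (fun x => |f₁ x - u x|) P.fst :=
      ((Integrable.of_bound hf₁m.aestronglyMeasurable b₁ (ae_of_all _ hf₁b)).sub hui).abs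
    have hdiP : Integrable (fun z : 𝓧 × Label => |f₁ z.1 - u z.1|) P :=
      hdi.comp_measurable measurable_fst
    have hmap : ∫ z, |f₁ z.1 - u z.1| ∂P = ∫ x, |f₁ x - u x| ∂P.fst := by
      rw [Measure.fst, integral_map measurable_fst.aemeasurable hdi.aestronglyMeasurable]
    have h1 := integral_mono (integrable_marginLoss hφ P hGm hb)
      ((integrable_marginLoss hφ P hf₁m hf₁b).add ((hdiP.const_mul L).add
        (integrable_const (L * τ)))) (fun z => by
        have h1 := hφ.sub_le ((z.2 : ℝ) * G i z.1) ((z.2 : ℝ) * f₁ z.1)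
        rw [← mul_sub, abs_mul, abs_label_coe, one_mul] at h1
        have h2 : |G i z.1 - f₁ z.1| ≤ |f₁ z.1 - u z.1| + τ := by
          have h3 : |u z.1 - G i z.1| ≤ τ := hi z.1
          have h4 := abs_sub_le (f₁ z.1) (u z.1) (G i z.1)
          rw [abs_sub_comm]; linarith
        have h3 := mul_le_mul_of_nonneg_left h2 hL.le
        simp only [Pi.add_apply]
        linarith)
    rw [integral_add' (integrable_marginLoss hφ P hf₁m hf₁b) ((hdiP.const_mul L).add
        (integrable_const (L * τ))), integral_add' (hdiP.const_mul L) (integrable_const (L * τ)),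
        integral_const_mul, hmap] at h1
    simp only [integral_const, probReal_univ, one_smul] at h1
    have h2 := mul_le_mul_of_nonneg_left hu hL.le
    have h3 : L * τ = δ / 2 := by rw [hτ]; field_simp
    simp only [Real.norm_eq_abs] at h2
    change marginRisk φ P (G i) ≤ marginRisk φ P f₁ + _ at h1
    linarith
  refine ⟨i, δ, hδ0, fun f hf ⟨b, hb⟩ hle => ?_⟩
  obtain ⟨f₂, hf₂m, hf₂b, hf₂⟩ := exists_sq_excess_le hφ P hf hb
  have h1 : sInf S ≤ marginRisk φ P f₂ := csInf_le hSbdd ⟨f₂, hf₂m, hf₂b, rfl⟩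
  have h2 : c * (generalizationError P f - bayesError P) ^ 2 ≤ c * ε ^ 2 := by
    have : c * ε ^ 2 = 4 * δ := by rw [hδ]; ring
    linarith
  have h3 := le_of_mul_le_mul_left h2 hc0
  linarith [(abs_le_of_sq_le_sq' h3 hε.le).2]

end Calibration

/-! ### Feature map, representer theorem and existence of minimizers -/

section FeatureMap

/-- A universal kernel has a continuous feature map into a Hilbert space whose linear functionals
are uniformly dense in the continuous functions. -/
theorem IsUniversalKernel.exists_featureMap.{u} {𝓧 : Type u} [TopologicalSpace 𝓧] [CompactSpace 𝓧]
    {K : 𝓧 → 𝓧 → ℝ} (hK : IsUniversalKernel K) :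
    ∃ (H : Type u) (_ : NormedAddCommGroup H) (_ : InnerProductSpace ℝ H) (_ : CompleteSpace H)
      (Φ : 𝓧 → H), Continuous Φ ∧ (∀ x y, inner ℝ (Φ x) (Φ y) = K x y) ∧
      ∀ u : C(𝓧, ℝ), ∀ ε > 0, ∃ g : H, ∀ x, |u x - inner ℝ (Φ x) g| ≤ ε := by
  have hfact : Fact (opKernel K).PosSemidef := ⟨opKernel_posSemidef hK.posSemidef⟩
  set Φ : 𝓧 → RKHS.OfKernel (opKernel K) :=
    fun x => RKHS.kerFun (RKHS.OfKernel (opKernel K)) x (1 : ℝ) with hΦ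
  have hinner : ∀ x (g : RKHS.OfKernel (opKernel K)), inner ℝ (Φ x) g = g x := fun x g => by
    rw [hΦ, RKHS.kerFun_inner]; simp
  have hker : ∀ x y, inner ℝ (Φ x) (Φ y) = K x y := fun x y => by
    rw [hinner, hΦ, RKHS.kerFun_apply, RKHS.OfKernel.kernel_ofKernel]
    simp [opKernel]
  refine ⟨RKHS.OfKernel (opKernel K), inferInstance, inferInstance, inferInstance, Φ, ?_, hker,
    fun u ε hε => ?_⟩
  · rw [continuous_iff_continuousAt]
    intro x
    rw [ContinuousAt, tendsto_iff_norm_sub_tendsto_zero]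
    -- Expanding the square expresses the distance through `K` alone, so continuity of `K` gives
    -- continuity of `Φ`.
    have hsq : ∀ y, ‖Φ y - Φ x‖ = √(K y y - 2 * K y x + K x x) := fun y => by
      rw [← hker y y, ← hker y x, ← hker x x, real_inner_self_eq_norm_sq,
        real_inner_self_eq_norm_sq, ← norm_sub_sq_real, Real.sqrt_sq (norm_nonneg _)]
    have hc : Continuous fun y => √(K y y - 2 * K y x + K x x) := by
      have h1 : Continuous fun y => K y y := hK.continuous.comp (continuous_id.prodMk continuous_id)
      have h2 : Continuous fun y => K y x :=
        hK.continuous.comp (continuous_id.prodMk continuous_const)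
      exact ((h1.sub (h2.const_mul 2)).add continuous_const).sqrt
    simp only [hsq]
    have := hc.tendsto x
    simpa [two_mul] using this
  · obtain ⟨v, ⟨g, hg⟩, hv⟩ := hK.dense.exists_dist_lt u hε
    refine ⟨g, fun x => ?_⟩
    rw [hinner, hg, ← Real.dist_eq]
    exact (ContinuousMap.dist_apply_le_dist x).trans hv.le

variable {𝓧 : Type*} {H : Type*} [NormedAddCommGroup H] [InnerProductSpace ℝ H]

/-- The feature vector of a labelled point multiplied by its label. -/
noncomputable def labelFeature (Φ : 𝓧 → H) (z : 𝓧 × Label) : H := (z.2 : ℝ) • Φ z.1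

/-- The label of a labelled point as a real number. -/
def labelSign (z : 𝓧 × Label) : ℝ := z.2

variable {K : 𝓧 → 𝓧 → ℝ} {Φ : 𝓧 → H}

theorem margin_labelFeature (α : ℝ) (g : H) (z : 𝓧 × Label) :
    margin (labelFeature Φ) labelSign α g z = (z.2 : ℝ) * (α + inner ℝ (Φ z.1) g) := by
  simp only [margin, labelFeature, labelSign, inner_smul_left]
  simp; ring

theorem kernelExpansion_eq (hΦ : ∀ x y, inner ℝ (Φ x) (Φ y) = K x y) {n : ℕ}
    (T : Fin n → 𝓧 × Label) (α : ℝ) (β : Fin n → ℝ) (x : 𝓧) :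
    kernelExpansion K T α β x = α + inner ℝ (Φ x) (∑ j, β j • Φ (T j).1) := by
  simp [kernelExpansion, inner_sum, inner_smul_right, hΦ]

theorem cRegObjective_eq (hΦ : ∀ x y, inner ℝ (Φ x) (Φ y) = K x y) {ρ γ : ℝ}
    {n : ℕ} (T : Fin n → 𝓧 × Label) (α : ℝ) (β : Fin n → ℝ) :
    cRegObjective K ρ γ T α β =
      regEmpRisk (cLoss ρ 1) (labelFeature Φ) labelSign γ T α (∑ j, β j • Φ (T j).1) := by
  have h1 : ‖∑ j, β j • Φ (T j).1‖ ^ 2 = ∑ i, ∑ j, β i * K (T i).1 (T j).1 * β j := by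
    rw [← real_inner_self_eq_norm_sq, sum_inner]
    refine Finset.sum_congr rfl fun i _ => ?_
    rw [inner_sum]
    refine Finset.sum_congr rfl fun j _ => ?_
    rw [inner_smul_left, inner_smul_right, hΦ]
    simp; ring
  simp only [cRegObjective, regEmpRisk, empMean, margin_labelFeature, h1, smul_eq_mul,
    kernelExpansion_eq hΦ]

/-- Representer theorem: projecting onto the span of the sample does not increase the regularized
empirical risk. -/
theorem exists_representer (φ : ℝ → ℝ) {γ : ℝ} (hγ : 0 ≤ γ) {n : ℕ} (T : Fin n → 𝓧 × Label)
    (Φ : 𝓧 → H) (g : H) :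
    ∃ β : Fin n → ℝ, ∀ α, regEmpRisk φ (labelFeature Φ) labelSign γ T α (∑ j, β j • Φ (T j).1) ≤
      regEmpRisk φ (labelFeature Φ) labelSign γ T α g := by
  set V := Submodule.span ℝ (Set.range fun j => Φ (T j).1)
  have : FiniteDimensional ℝ V := FiniteDimensional.span_of_finite ℝ (Set.finite_range _)
  obtain ⟨β, hβ⟩ := (Submodule.mem_span_range_iff_exists_fun ℝ).mp (V.starProjection_apply_mem g)
  refine ⟨β, fun α => ?_⟩
  rw [hβ]
  have hmem : ∀ i, Φ (T i).1 ∈ V := fun i => Submodule.subset_span ⟨i, rfl⟩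
  have hin : ∀ i, inner ℝ (Φ (T i).1) (V.starProjection g) = inner ℝ (Φ (T i).1) g := fun i => by
    rw [← Submodule.inner_starProjection_left_eq_right,
      Submodule.starProjection_eq_self_iff.mpr (hmem i)]
  have hnorm : ‖V.starProjection g‖ ≤ ‖g‖ := V.norm_starProjection_apply_le g
  simp only [regEmpRisk, empMean, margin_labelFeature, hin]
  gcongr

theorem exists_forall_le_of_sublevel_bounded {E : Type*} [NormedAddCommGroup E] [ProperSpace E]
    {J : E → ℝ} (hJ : Continuous J) {x₀ : E} {c r : ℝ} (hx₀ : J x₀ ≤ c)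
    (hr : ∀ x, J x ≤ c → ‖x‖ ≤ r) : ∃ m, ∀ x, J m ≤ J x := by
  have hmem : ∀ x, J x ≤ c → x ∈ Metric.closedBall (0 : E) r := fun x hx => by simpa using hr x hx
  obtain ⟨m, -, hm⟩ := (isCompact_closedBall (0 : E) r).exists_isMinOn
    ⟨x₀, hmem x₀ hx₀⟩ hJ.continuousOn
  refine ⟨m, fun x => ?_⟩
  by_cases hx : J x ≤ c
  · exact hm (hmem x hx)
  · exact (hm (hmem x₀ hx₀)).trans (hx₀.trans (not_le.mp hx).le)

theorem continuous_regEmpRisk {φ : ℝ → ℝ} (hφ : Continuous φ) (γ : ℝ) {n : ℕ}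
    (T : Fin n → 𝓧 × Label) (Φ : 𝓧 → H) :
    Continuous fun p : ℝ × H => regEmpRisk φ (labelFeature Φ) labelSign γ T p.1 p.2 := by
  unfold regEmpRisk empMean margin
  fun_prop

variable {φ φ' : ℝ → ℝ} {L M : ℝ}

theorem norm_labelFeature_le {κ : ℝ} (hκ : ∀ x, ‖Φ x‖ ≤ κ) (z : 𝓧 × Label) :
    ‖labelFeature Φ z‖ ≤ κ := by
  rw [labelFeature, norm_smul, Real.norm_eq_abs, abs_label_coe, one_mul]; exact hκ _

theorem norm_le_of_regEmpRisk_le_one (hφ : IsMarginLoss φ φ' L M) {γ : ℝ} (hγ : 0 < γ) {n : ℕ}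
    {T : Fin n → 𝓧 × Label} {α : ℝ} {g : H}
    (hle : regEmpRisk φ (labelFeature Φ) labelSign γ T α g ≤ 1) : ‖g‖ ≤ √(2 / γ) := by
  refine Real.le_sqrt_of_sq_le ?_
  rw [le_div_iff₀ hγ, mul_comm]
  exact mul_sq_norm_le_two hφ hle

theorem abs_offset_le (hφ : IsMarginLoss φ φ' L M) {κ γ p : ℝ} (hκ : ∀ x, ‖Φ x‖ ≤ κ) (hγ : 0 < γ)
    {n : ℕ} {T : Fin n → 𝓧 × Label} {α : ℝ} {g : H}
    (hle : regEmpRisk φ (labelFeature Φ) labelSign γ T α g ≤ 1) (hp : 0 < p)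
    (hpos : p ≤ empMean T (fun z => (1 + 1 * labelSign z) / 2))
    (hneg : p ≤ empMean T (fun z => (1 + -1 * labelSign z) / 2)) :
    |α| ≤ κ * ‖g‖ + 1 / (-φ' 0 * p) := by
  have h1 := neg_mul_offset_le hφ (norm_labelFeature_le hκ) (fun z => label_coe z.2) hγ.le hle
    (Or.inl rfl) hp hpos
  have h2 := neg_mul_offset_le hφ (norm_labelFeature_le hκ) (fun z => label_coe z.2) hγ.le hle
    (Or.inr rfl) hp hneg
  exact abs_le.mpr ⟨by linarith, by linarith⟩

theorem one_div_le_empMean_of_label {n : ℕ} {T : Fin n → 𝓧 × Label} {y : ℝ} (hy : y = 1 ∨ y = -1)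
    {i : Fin n} (hi : ((T i).2 : ℝ) = y) :
    1 / (n : ℝ) ≤ empMean T (fun z => (1 + y * labelSign z) / 2) := by
  have h1 : (1 : ℝ) ≤ ∑ i, (1 + y * labelSign (T i)) / 2 := by
    refine le_trans (le_of_eq ?_) (Finset.single_le_sum
      (f := fun i => (1 + y * labelSign (T i)) / 2) (fun j _ => ?_) (Finset.mem_univ i))
    · simp only [labelSign, hi]; rcases hy with h | h <;> rw [h] <;> norm_num
    · simp only [labelSign]
      rcases hy with h | h <;> rcases label_coe (T j).2 with h' | h' <;> rw [h, h'] <;> norm_num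
  have := mul_le_mul_of_nonneg_left h1 (show 0 ≤ 1 / (n : ℝ) by positivity)
  simpa [empMean] using this

/-- On the span of the sample the sublevel set at `1`, the value of the zero function, is bounded:
the regularizer controls `g`, and both labels having frequency at least `1 / n` controls the offset.
Projection extends minimality from the span to all of `H`. -/
theorem exists_minimizer_offset (hφ : IsMarginLoss φ φ' L M) {γ : ℝ} (hγ : 0 < γ)
    {n : ℕ} (hn : 0 < n) {T : Fin n → 𝓧 × Label} (hT : ∃ i j, (T i).2 ≠ (T j).2) (Φ : 𝓧 → H)
    {κ : ℝ} (hκ : ∀ x, ‖Φ x‖ ≤ κ) :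
    ∃ (α : ℝ) (β : Fin n → ℝ), ∀ (α' : ℝ) (g : H),
      regEmpRisk φ (labelFeature Φ) labelSign γ T α (∑ j, β j • Φ (T j).1) ≤
        regEmpRisk φ (labelFeature Φ) labelSign γ T α' g := by
  have hn' : (0 : ℝ) < n := by exact_mod_cast hn
  obtain ⟨i, hi⟩ : ∃ i, ((T i).2 : ℝ) = 1 := by
    obtain ⟨i, j, hij⟩ := hT
    by_contra hcon
    push Not at hcon
    exact hij (Subtype.ext (((label_coe _).resolve_left (hcon i)).trans
      ((label_coe _).resolve_left (hcon j)).symm))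
  obtain ⟨j, hj⟩ : ∃ j, ((T j).2 : ℝ) = -1 := by
    obtain ⟨i, j, hij⟩ := hT
    by_contra hcon
    push Not at hcon
    exact hij (Subtype.ext (((label_coe _).resolve_right (hcon i)).trans
      ((label_coe _).resolve_right (hcon j)).symm))
  have hκ0 : 0 ≤ κ := (norm_nonneg _).trans (hκ (T i).1)
  set V := Submodule.span ℝ (Set.range fun j => Φ (T j).1)
  have : FiniteDimensional ℝ V := FiniteDimensional.span_of_finite ℝ (Set.finite_range _)
  have : ProperSpace V := FiniteDimensional.proper ℝ V
  obtain ⟨⟨α, v⟩, hmin⟩ := exists_forall_le_of_sublevel_bounded (E := ℝ × V)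
    (J := fun p => regEmpRisk φ (labelFeature Φ) labelSign γ T p.1 (p.2 : H))
    ((continuous_regEmpRisk hφ.continuous γ T Φ).comp
      (continuous_fst.prodMk (continuous_subtype_val.comp continuous_snd)))
    (x₀ := (0, 0)) (c := 1)
    (r := max (κ * √(2 / γ) + 1 / (-φ' 0 * (1 / (n : ℝ)))) √(2 / γ))
    (by simpa only [ZeroMemClass.coe_zero] using (regEmpRisk_zero hφ hn T).le) (by
      rintro ⟨a, w⟩ hle
      have h1 := norm_le_of_regEmpRisk_le_one hφ hγ hle
      have h2 := abs_offset_le hφ hκ hγ hle (one_div_pos.mpr hn')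
        (one_div_le_empMean_of_label (Or.inl rfl) hi) (one_div_le_empMean_of_label (Or.inr rfl) hj)
      rw [Prod.norm_def]
      refine max_le_max ?_ h1
      have := mul_le_mul_of_nonneg_left h1 hκ0
      rw [Real.norm_eq_abs]; linarith)
  obtain ⟨β, hβ⟩ := (Submodule.mem_span_range_iff_exists_fun ℝ).mp v.2
  refine ⟨α, β, fun α' g => ?_⟩
  obtain ⟨β', hβ'⟩ := exists_representer φ hγ.le T Φ g
  rw [hβ]
  refine le_trans (hmin (α', ⟨∑ j, β' j • Φ (T j).1, ?_⟩)) (hβ' α')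
  exact (Submodule.mem_span_range_iff_exists_fun ℝ).mpr ⟨β', rfl⟩

/-- Here the regularizer alone bounds the sublevel set on the span, so both labels need not occur.
-/
theorem exists_minimizer_noOffset (hφ : IsMarginLoss φ φ' L M) {γ : ℝ} (hγ : 0 < γ)
    {n : ℕ} (hn : 0 < n) (T : Fin n → 𝓧 × Label) (Φ : 𝓧 → H) :
    ∃ β : Fin n → ℝ, ∀ g : H,
      regEmpRisk φ (labelFeature Φ) labelSign γ T 0 (∑ j, β j • Φ (T j).1) ≤
        regEmpRisk φ (labelFeature Φ) labelSign γ T 0 g := by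
  set V := Submodule.span ℝ (Set.range fun j => Φ (T j).1)
  have : FiniteDimensional ℝ V := FiniteDimensional.span_of_finite ℝ (Set.finite_range _)
  have : ProperSpace V := FiniteDimensional.proper ℝ V
  have hcont : Continuous fun w : V =>
      regEmpRisk φ (labelFeature Φ) labelSign γ T 0 (w : H) := by
    have h : Continuous fun w : V => ((0 : ℝ), (w : H)) := by fun_prop
    exact (continuous_regEmpRisk hφ.continuous γ T Φ).comp h
  have hzero : regEmpRisk φ (labelFeature Φ) labelSign γ T 0 ((0 : V) : H) ≤ 1 := by
    rw [ZeroMemClass.coe_zero]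
    exact (regEmpRisk_zero hφ hn T).le
  have hbdd : ∀ w : V, regEmpRisk φ (labelFeature Φ) labelSign γ T 0 (w : H) ≤ 1 →
      ‖w‖ ≤ √(2 / γ) := fun w hle => by
    have := norm_le_of_regEmpRisk_le_one (g := (w : H)) hφ hγ hle
    rwa [Submodule.norm_coe] at this
  obtain ⟨v, hmin⟩ := exists_forall_le_of_sublevel_bounded hcont hzero hbdd
  obtain ⟨β, hβ⟩ := (Submodule.mem_span_range_iff_exists_fun ℝ).mp v.2
  refine ⟨β, fun g => ?_⟩
  obtain ⟨β', hβ'⟩ := exists_representer φ hγ.le T Φ g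
  rw [hβ]
  refine le_trans (hmin ⟨∑ j, β' j • Φ (T j).1, ?_⟩) (hβ' 0)
  exact (Submodule.mem_span_range_iff_exists_fun ℝ).mpr ⟨β', rfl⟩

theorem exists_isCRegClassifier (hΦ : ∀ x y, inner ℝ (Φ x) (Φ y) = K x y)
    {ρ : ℝ} (hφ : IsMarginLoss (cLoss ρ 1) φ' L M) {γ : ℕ → ℝ}
    (hγ : ∀ n, 0 < γ n) {κ : ℝ} (hκ : ∀ x, ‖Φ x‖ ≤ κ) : ∃ f, IsCRegClassifier K ρ γ f := by
  classical
  have key : ∀ n (T : Fin n → 𝓧 × Label), ∃ f : 𝓧 → ℝ, 0 < n →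
      ((∃ i j, (T i).2 ≠ (T j).2) → ∃ (α : ℝ) (β : Fin n → ℝ),
        (∀ (α' : ℝ) (β' : Fin n → ℝ),
          cRegObjective K ρ (γ n) T α β ≤ cRegObjective K ρ (γ n) T α' β') ∧
        f = kernelExpansion K T α β) ∧
      (∀ y : Label, (∀ i, (T i).2 = y) → ∃ a : ℝ, 0 < (y : ℝ) * a ∧ f = fun _ => a) := by
    intro n T
    rcases Nat.eq_zero_or_pos n with hn | hn
    · exact ⟨0, fun h => absurd hn h.ne'⟩
    by_cases hT : ∃ i j, (T i).2 ≠ (T j).2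
    · obtain ⟨α, β, h⟩ := exists_minimizer_offset hφ (hγ n) hn hT Φ hκ
      refine ⟨kernelExpansion K T α β, fun _ => ⟨fun _ => ⟨α, β, fun α' β' => ?_, rfl⟩,
        fun y hy => ?_⟩⟩
      · rw [cRegObjective_eq hΦ, cRegObjective_eq hΦ]; exact h _ _
      · obtain ⟨i, j, hij⟩ := hT
        exact absurd ((hy i).trans (hy j).symm) hij
    · refine ⟨fun _ => ((T ⟨0, hn⟩).2 : ℝ), fun _ => ⟨fun h => absurd h hT, fun y hy => ?_⟩⟩
      refine ⟨_, ?_, rfl⟩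
      rw [hy]
      rcases label_coe y with h | h <;> rw [h] <;> norm_num
  choose f hf using key
  exact ⟨f, fun n hn T => hf n T hn⟩

theorem exists_isCRegClassifierNoOffset (hΦ : ∀ x y, inner ℝ (Φ x) (Φ y) = K x y)
    {ρ : ℝ} (hφ : IsMarginLoss (cLoss ρ 1) φ' L M)
    {γ : ℕ → ℝ} (hγ : ∀ n, 0 < γ n) : ∃ f, IsCRegClassifierNoOffset K ρ γ f := by
  have key : ∀ n (T : Fin n → 𝓧 × Label), ∃ f : 𝓧 → ℝ, 0 < n → ∃ β : Fin n → ℝ,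
      (∀ β' : Fin n → ℝ, cRegObjective K ρ (γ n) T 0 β ≤ cRegObjective K ρ (γ n) T 0 β') ∧
      f = kernelExpansion K T 0 β := by
    intro n T
    rcases Nat.eq_zero_or_pos n with hn | hn
    · exact ⟨0, fun h => absurd hn h.ne'⟩
    obtain ⟨β, h⟩ := exists_minimizer_noOffset hφ (hγ n) hn T Φ
    refine ⟨kernelExpansion K T 0 β, fun _ => ⟨β, fun β' => ?_, rfl⟩⟩
    rw [cRegObjective_eq hΦ, cRegObjective_eq hΦ]; exact h _
  choose f hf using key
  exact ⟨f, fun n hn T => hf n T hn⟩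

end FeatureMap

/-! ### Deviation probabilities and the deterministic consistency bound -/

section Consistency

theorem measurable_labelSign {𝓧 : Type*} [MeasurableSpace 𝓧] :
    Measurable (labelSign : 𝓧 × Label → ℝ) := measurable_label_coe

theorem abs_labelSign_le {𝓧 : Type*} (z : 𝓧 × Label) : |labelSign z| ≤ 1 :=
  (abs_label_coe z.2).le

theorem stronglyMeasurable_labelFeature {𝓧 H : Type*} [MeasurableSpace 𝓧] [TopologicalSpace 𝓧]
    [OpensMeasurableSpace 𝓧] [SecondCountableTopology 𝓧] [NormedAddCommGroup H]
    [InnerProductSpace ℝ H] {Φ : 𝓧 → H} (hΦc : Continuous Φ) :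
    StronglyMeasurable (labelFeature Φ) :=
  measurable_label_coe.stronglyMeasurable.smul
    (hΦc.stronglyMeasurable.comp_measurable measurable_fst)

/-- For a fixed `F` the exponent could be `c * n`; it is weakened, using `γ ≤ 1`, to match the form
of the other deviation bounds. -/
theorem exists_measure_deviation_fixed_le {𝓧 : Type*} [MeasurableSpace 𝓧]
    (P : Measure (𝓧 × Label)) [IsProbabilityMeasure P]
    {F : 𝓧 × Label → ℝ} (hF : Measurable F) {B : ℝ} (hB : ∀ z, |F z| ≤ B) {δ : ℝ} (hδ : 0 < δ) :
    ∃ c > 0, ∀ γ, 0 < γ → γ ≤ 1 → ∀ n : ℕ, 0 < n → (Measure.infinitePi fun _ : ℕ => P)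
      {ω | δ ≤ ‖empMean (fun i : Fin n => ω i) F - ∫ z, F z ∂P‖} ≤
        ENNReal.ofReal (2 * Real.exp (-(c * (n * γ ^ 2)))) := by
  have hB0 : 0 ≤ B := by
    obtain ⟨z⟩ := nonempty_of_isProbabilityMeasure P
    exact (abs_nonneg _).trans (hB z)
  refine ⟨δ ^ 2 / (8 * (B + 1) ^ 2), by positivity, fun γ hγ hγ1 n hn => ?_⟩
  refine (infinitePi_empMean_sub_integral_ge_le P hF.stronglyMeasurable (B := B + 1)
    (by positivity) (fun z => (hB z).trans (by linarith)) hn hδ.le).trans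
    (ENNReal.ofReal_le_ofReal ?_)
  gcongr
  calc δ ^ 2 / (8 * (B + 1) ^ 2) * (n * γ ^ 2) ≤ δ ^ 2 / (8 * (B + 1) ^ 2) * (n * 1) := by
        gcongr; exact pow_le_one₀ hγ.le hγ1
    _ = _ := by ring

theorem continuous_decision {𝓧 H : Type*} [TopologicalSpace 𝓧] [NormedAddCommGroup H]
    [InnerProductSpace ℝ H] {Φ : 𝓧 → H} (hΦc : Continuous Φ) (α : ℝ) (g : H) :
    Continuous fun x => α + inner ℝ (Φ x) g := by fun_prop

theorem abs_decision_le {𝓧 H : Type*} [NormedAddCommGroup H] [InnerProductSpace ℝ H] {Φ : 𝓧 → H}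
    {κ : ℝ} (hκ : ∀ x, ‖Φ x‖ ≤ κ) (α : ℝ) (g : H) (x : 𝓧) :
    |α + inner ℝ (Φ x) g| ≤ |α| + κ * ‖g‖ :=
  (abs_add_le _ _).trans (add_le_add le_rfl ((abs_real_inner_le_norm _ _).trans
    (mul_le_mul_of_nonneg_right (hκ x) (norm_nonneg g))))

variable {𝓧 : Type*} [MeasurableSpace 𝓧] [TopologicalSpace 𝓧] [BorelSpace 𝓧]
  [SecondCountableTopology 𝓧]
  {H : Type*} [NormedAddCommGroup H] [InnerProductSpace ℝ H] [CompleteSpace H]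
  {φ φ' : ℝ → ℝ} {L M : ℝ} {Φ : 𝓧 → H} {κ : ℝ}

/-- Exponential bound for the probability that the empirical gradient or the empirical risk at a
stationary point deviates from its expectation. -/
theorem exists_measure_deviation_le (hφ : IsMarginLoss φ φ' L M) (P : Measure (𝓧 × Label))
    [IsProbabilityMeasure P] (hΦc : Continuous Φ) (hκ0 : 0 < κ) (hκ : ∀ x, ‖Φ x‖ ≤ κ)
    {A η δ : ℝ} (hA : 0 ≤ A) (hη : 0 < η) (hδ : 0 < δ) :
    ∃ c > 0, ∀ γ, 0 < γ → γ ≤ 1 → ∀ α, |α| ≤ A / γ → ∀ h : H,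
      γ • h + ∫ z, φ' (margin (labelFeature Φ) labelSign α h z) • labelFeature Φ z ∂P = 0 →
      ∀ n : ℕ, 0 < n → (Measure.infinitePi fun _ : ℕ => P)
        ({ω | γ * η ≤ ‖empMean (fun i : Fin n => ω i)
              (fun z => φ' (margin (labelFeature Φ) labelSign α h z) • labelFeature Φ z) -
              ∫ z, φ' (margin (labelFeature Φ) labelSign α h z) • labelFeature Φ z ∂P‖} ∪
          {ω | δ ≤ ‖empMean (fun i : Fin n => ω i)
              (fun z => φ (margin (labelFeature Φ) labelSign α h z)) -
              ∫ z, φ (margin (labelFeature Φ) labelSign α h z) ∂P‖}) ≤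
        ENNReal.ofReal (4 * Real.exp (-(c * (n * γ ^ 2)))) := by
  have hL := hφ.L_pos
  -- With `‖h‖ ≤ L * κ / γ` and `|α| ≤ A / γ`, the loss at `h` is at most `D / γ`. Thus Hoeffding at
  -- level `δ` has exponent of order `n γ²`, as it has for the gradient, which is bounded by `L * κ`
  -- and tested at level `γ * η`.
  set D := 1 + L * (κ * (L * κ) + A) with hD
  have hD0 : 0 < D := by positivity
  refine ⟨min (η ^ 2 / (8 * (L * κ) ^ 2)) (δ ^ 2 / (8 * D ^ 2)), by positivity,
    fun γ hγ hγ1 α hα h hst n hn => ?_⟩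
  set c := min (η ^ 2 / (8 * (L * κ) ^ 2)) (δ ^ 2 / (8 * D ^ 2)) with hc
  have hΨm := stronglyMeasurable_labelFeature hΦc
  have hΨ := norm_labelFeature_le hκ
  have hmm := stronglyMeasurable_margin hΨm measurable_labelSign α h
  have hh := norm_stationary_le hφ P hΨ hγ hst
  have hX : 0 ≤ n * γ ^ 2 := by positivity
  have b1 := infinitePi_empMean_sub_integral_ge_le P (B := L * κ) (n := n) (ε := γ * η)
    ((hφ.continuous'.comp_stronglyMeasurable hmm).smul hΨm) (by positivity) (fun z => by
      rw [Pi.smul_apply', norm_smul, Real.norm_eq_abs]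
      exact mul_le_mul (hφ.bound _) (hΨ z) (norm_nonneg _) hL.le) hn (by positivity)
  have b2 := infinitePi_empMean_sub_integral_ge_le P (B := D / γ) (n := n) (ε := δ)
    (hφ.continuous.comp_stronglyMeasurable hmm) (by positivity) (fun z => by
      rw [Real.norm_of_nonneg (hφ.nonneg _)]
      refine (hφ.le_one_add _).trans ?_
      have h1 := abs_margin_le hΨ abs_labelSign_le α h z
      have h2 : κ * ‖h‖ + |α| ≤ (κ * (L * κ) + A) / γ := by
        have := mul_le_mul_of_nonneg_left hh hκ0.le
        rw [add_div, mul_div_assoc]; linarith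
      have h3 := mul_le_mul_of_nonneg_left (h1.trans h2) hL.le
      have h4 : 1 ≤ 1 / γ := by rw [le_div_iff₀ hγ]; linarith
      have h5 : D / γ = 1 / γ + L * ((κ * (L * κ) + A) / γ) := by rw [hD]; ring
      rw [h5]; linarith) hn hδ.le
  refine (measure_union_le _ _).trans ((add_le_add b1 b2).trans ?_)
  rw [← ENNReal.ofReal_add (by positivity) (by positivity)]
  refine ENNReal.ofReal_le_ofReal ?_
  have e1 : Real.exp (-(n * (γ * η) ^ 2 / (8 * (L * κ) ^ 2))) ≤ Real.exp (-(c * (n * γ ^ 2))) := by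
    refine Real.exp_le_exp.mpr (neg_le_neg ?_)
    calc c * (n * γ ^ 2) ≤ η ^ 2 / (8 * (L * κ) ^ 2) * (n * γ ^ 2) :=
          mul_le_mul_of_nonneg_right (min_le_left _ _) hX
      _ = _ := by ring
  have e2 : Real.exp (-(n * δ ^ 2 / (8 * (D / γ) ^ 2))) ≤ Real.exp (-(c * (n * γ ^ 2))) := by
    refine Real.exp_le_exp.mpr (neg_le_neg ?_)
    calc c * (n * γ ^ 2) ≤ δ ^ 2 / (8 * D ^ 2) * (n * γ ^ 2) :=
          mul_le_mul_of_nonneg_right (min_le_right _ _) hX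
      _ = _ := by field_simp
  linarith

/-- Deterministic part of the consistency proof: if three empirical means are close to their
expectations, then the generalization error of a minimizer is close to the Bayes error. -/
theorem exists_generalizationError_le {𝓧 : Type*} [MeasurableSpace 𝓧] [TopologicalSpace 𝓧]
    [BorelSpace 𝓧] [SecondCountableTopology 𝓧] [T2Space 𝓧] [CompactSpace 𝓧]
    {H : Type*} [NormedAddCommGroup H] [InnerProductSpace ℝ H] {Φ : 𝓧 → H}
    (hφ : IsMarginLoss φ φ' L M) (P : Measure (𝓧 × Label)) [IsProbabilityMeasure P]
    (hΦc : Continuous Φ) (hκ0 : 0 < κ) (hκ : ∀ x, ‖Φ x‖ ≤ κ)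
    (hdense : ∀ u : C(𝓧, ℝ), ∀ ε > 0, ∃ g : H, ∀ x, |u x - inner ℝ (Φ x) g| ≤ ε)
    {ε : ℝ} (hε : 0 < ε) :
    ∃ (g₀ : H) (η δ : ℝ), 0 < η ∧ 0 < δ ∧ ∀ γ, 0 < γ → γ ≤ 1 → γ / 2 * ‖g₀‖ ^ 2 ≤ δ →
      ∀ (n : ℕ) (T : Fin n → 𝓧 × Label) (α α' : ℝ) (g h : H), 0 < n →
      γ • h + ∫ z, φ' (margin (labelFeature Φ) labelSign α' h z) • labelFeature Φ z ∂P = 0 →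
      |α - α'| ≤ γ * η →
      ‖empMean T (fun z => φ' (margin (labelFeature Φ) labelSign α' h z) • labelFeature Φ z) -
        ∫ z, φ' (margin (labelFeature Φ) labelSign α' h z) • labelFeature Φ z ∂P‖ ≤ γ * η →
      |empMean T (fun z => φ (margin (labelFeature Φ) labelSign α' h z)) -
        ∫ z, φ (margin (labelFeature Φ) labelSign α' h z) ∂P| ≤ δ →
      |empMean T (fun z => φ (margin (labelFeature Φ) labelSign 0 g₀ z)) -
        ∫ z, φ (margin (labelFeature Φ) labelSign 0 g₀ z) ∂P| ≤ δ →
      regEmpRisk φ (labelFeature Φ) labelSign γ T α g ≤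
        regEmpRisk φ (labelFeature Φ) labelSign γ T α' h →
      regEmpRisk φ (labelFeature Φ) labelSign γ T α g ≤
        regEmpRisk φ (labelFeature Φ) labelSign γ T 0 g₀ →
      generalizationError P (fun x => α + inner ℝ (Φ x) g) ≤ bayesError P + ε := by
  obtain ⟨g₀, e, he, hcomp⟩ := exists_competitor hφ P (fun (g : H) x => inner ℝ (Φ x) g)
    (fun g => by fun_prop) hdense hε
  have hL := hφ.L_pos
  -- The tolerance `e` of the competitor is split as `3 * (e / 6) + e / 4 + e / 4` between the terms
  -- `3 * δ`, `2 * L * κ * τ` and `2 * L * η` of `risk_le_of_deviations`.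
  set τ := e / (8 * L * κ) with hτ
  have hτ0 : 0 < τ := by positivity
  set η := min (τ / 4) (min (τ ^ 2 / (4 * L)) (e / (8 * L))) with hη
  have hη0 : 0 < η := by positivity
  have hη1 : 4 * η ≤ τ := by linarith [min_le_left (τ / 4) (min (τ ^ 2 / (4 * L)) (e / (8 * L)))]
  have hη2 : 4 * L * η ≤ τ ^ 2 := by
    have : η ≤ τ ^ 2 / (4 * L) := (min_le_right _ _).trans (min_le_left _ _)
    rw [le_div_iff₀ (by positivity)] at this
    linarith
  have hη3 : 2 * L * η ≤ e / 4 := by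
    have : η ≤ e / (8 * L) := (min_le_right _ _).trans (min_le_right _ _)
    rw [le_div_iff₀ (by positivity)] at this
    linarith
  have hτ1 : 2 * L * (κ * τ) = e / 4 := by rw [hτ]; field_simp; norm_num
  refine ⟨g₀, η, e / 6, hη0, by positivity, fun γ hγ hγ1 hreg n T α α' g h hn hst hα hd1 hd2 hd3
    hm1 hm2 => ?_⟩
  have hrisk := risk_le_of_deviations hφ P (stronglyMeasurable_labelFeature hΦc)
    measurable_labelSign (norm_labelFeature_le hκ) abs_labelSign_le hγ hγ1 hst hn hη0.le hτ0 hη1 hη2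
    hα hd1 hd2 hd3 hreg hm1 hm2
  refine hcomp _ (continuous_decision hΦc α g).measurable ⟨_, abs_decision_le hκ α g⟩ ?_
  simp only [margin_labelFeature, zero_add] at hrisk
  simp only [marginRisk]
  linarith

end Consistency

/-! ### The classifier without offset; degenerate labels; bounds on the offset -/

section Classifiers

theorem IsCRegClassifierNoOffset.exists_minimizer {𝓧 H : Type*} [NormedAddCommGroup H]
    [InnerProductSpace ℝ H] {K : 𝓧 → 𝓧 → ℝ} {Φ : 𝓧 → H}
    (hΦ : ∀ x y, inner ℝ (Φ x) (Φ y) = K x y) {ρ : ℝ} {γ : ℕ → ℝ} (hγ : ∀ n, 0 < γ n)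
    {f : ∀ n : ℕ, (Fin n → 𝓧 × Label) → 𝓧 → ℝ} (hf : IsCRegClassifierNoOffset K ρ γ f)
    {n : ℕ} (hn : 0 < n) (T : Fin n → 𝓧 × Label) :
    ∃ g : H, (∀ g', regEmpRisk (cLoss ρ 1) (labelFeature Φ) labelSign (γ n) T 0 g ≤
      regEmpRisk (cLoss ρ 1) (labelFeature Φ) labelSign (γ n) T 0 g') ∧
      f n T = fun x => 0 + inner ℝ (Φ x) g := by
  obtain ⟨β, hβ, hfT⟩ := hf n hn T
  refine ⟨∑ j, β j • Φ (T j).1, fun g' => ?_, ?_⟩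
  · obtain ⟨β', hβ'⟩ := exists_representer (cLoss ρ 1) (hγ n).le T Φ g'
    have := hβ β'
    rw [cRegObjective_eq hΦ, cRegObjective_eq hΦ] at this
    exact this.trans (hβ' 0)
  · rw [hfT]; exact funext fun x => kernelExpansion_eq hΦ T 0 β x

theorem IsCRegClassifier.exists_minimizer {𝓧 H : Type*} [NormedAddCommGroup H]
    [InnerProductSpace ℝ H] {K : 𝓧 → 𝓧 → ℝ} {Φ : 𝓧 → H}
    (hΦ : ∀ x y, inner ℝ (Φ x) (Φ y) = K x y) {ρ : ℝ} {γ : ℕ → ℝ} (hγ : ∀ n, 0 < γ n)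
    {f : ∀ n : ℕ, (Fin n → 𝓧 × Label) → 𝓧 → ℝ} (hf : IsCRegClassifier K ρ γ f)
    {n : ℕ} (hn : 0 < n) (T : Fin n → 𝓧 × Label) (hT : ∃ i j, (T i).2 ≠ (T j).2) :
    ∃ (α : ℝ) (g : H), (∀ α' g', regEmpRisk (cLoss ρ 1) (labelFeature Φ) labelSign (γ n) T α g ≤
      regEmpRisk (cLoss ρ 1) (labelFeature Φ) labelSign (γ n) T α' g') ∧
      f n T = fun x => α + inner ℝ (Φ x) g := by
  obtain ⟨α, β, hβ, hfT⟩ := (hf n hn T).1 hT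
  refine ⟨α, ∑ j, β j • Φ (T j).1, fun α' g' => ?_, ?_⟩
  · obtain ⟨β', hβ'⟩ := exists_representer (cLoss ρ 1) (hγ n).le T Φ g'
    have := hβ α' β'
    rw [cRegObjective_eq hΦ, cRegObjective_eq hΦ] at this
    exact this.trans (hβ' α')
  · rw [hfT]; exact funext fun x => kernelExpansion_eq hΦ T α β x

variable {𝓧 : Type*} [MeasurableSpace 𝓧] [TopologicalSpace 𝓧] [BorelSpace 𝓧]
  [SecondCountableTopology 𝓧] [T2Space 𝓧] [CompactSpace 𝓧]
  {H : Type*} [NormedAddCommGroup H] [InnerProductSpace ℝ H] [CompleteSpace H]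
  {φ' : ℝ → ℝ} {L M : ℝ} {K : 𝓧 → 𝓧 → ℝ} {Φ : 𝓧 → H} {κ ρ : ℝ} {γ : ℕ → ℝ}

theorem eventually_mul_le {γ : ℕ → ℝ} (hγ_lim : Tendsto γ atTop (𝓝 0)) (a : ℝ) {δ : ℝ}
    (hδ : 0 < δ) : ∀ᶠ n in atTop, γ n / 2 * a ≤ δ := by
  have : Tendsto (fun n => γ n / 2 * a) atTop (𝓝 (0 / 2 * a)) := (hγ_lim.div_const 2).mul_const a
  simp only [zero_div, zero_mul] at this
  exact this.eventually_le_const hδ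

theorem universallyConsistent_noOffset (hφ : IsMarginLoss (cLoss ρ 1) φ' L M)
    (hΦ : ∀ x y, inner ℝ (Φ x) (Φ y) = K x y) (hΦc : Continuous Φ) (hκ0 : 0 < κ)
    (hκ : ∀ x, ‖Φ x‖ ≤ κ)
    (hdense : ∀ u : C(𝓧, ℝ), ∀ ε > 0, ∃ g : H, ∀ x, |u x - inner ℝ (Φ x) g| ≤ ε)
    (hγ : ∀ n, 0 < γ n) (hγ_lim : Tendsto γ atTop (𝓝 0))
    (hrate : Tendsto (fun n : ℕ => (n : ℝ) * γ n ^ 2) atTop atTop)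
    {f : ∀ n : ℕ, (Fin n → 𝓧 × Label) → 𝓧 → ℝ} (hf : IsCRegClassifierNoOffset K ρ γ f) :
    UniversallyConsistent f := by
  intro P _
  rw [tendstoInMeasure_iff_dist]
  intro ε hε
  set φ := cLoss ρ 1
  set Ψ := labelFeature Φ
  have hΨm := stronglyMeasurable_labelFeature hΦc
  -- Half of `ε`, since the event to be excluded is the non-strict `ε ≤ dist`.
  obtain ⟨g₀, η, δ, hη, hδ, hgood⟩ := exists_generalizationError_le hφ P hΦc hκ0 hκ hdense
    (half_pos hε)
  choose h hh using fun n => exists_stationary hφ P hΨm measurable_labelSign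
    (norm_labelFeature_le hκ) (hγ n) (0 : ℝ)
  obtain ⟨c₁, hc₁, hdev₁⟩ := exists_measure_deviation_le hφ P hΦc hκ0 hκ (le_refl 0) hη hδ
  obtain ⟨c₂, hc₂, hdev₂⟩ := exists_measure_deviation_fixed_le P
    (F := fun z => φ (margin Ψ labelSign 0 g₀ z)) (B := 1 + L * (κ * ‖g₀‖ + |0|))
    (hφ.continuous.measurable.comp
      (stronglyMeasurable_margin hΨm measurable_labelSign 0 g₀).measurable) (fun z => by
      rw [abs_of_nonneg (hφ.nonneg _)]
      have := mul_le_mul_of_nonneg_left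
        (abs_margin_le (norm_labelFeature_le hκ) abs_labelSign_le 0 g₀ z) hφ.L_pos.le
      linarith [hφ.le_one_add (margin Ψ labelSign 0 g₀ z)]) hδ
  have hlim : ∀ a c : ℝ, 0 < c → Tendsto (fun n : ℕ =>
      ENNReal.ofReal (a * Real.exp (-(c * (n * γ n ^ 2))))) atTop (𝓝 0) := fun a c hc => by
    have h1 := Real.tendsto_exp_neg_atTop_nhds_zero.comp (hrate.const_mul_atTop hc)
    have h2 := ENNReal.tendsto_ofReal (h1.const_mul a)
    simpa using h2
  have hsum := (hlim 4 c₁ hc₁).add (hlim 2 c₂ hc₂)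
  rw [add_zero] at hsum
  refine tendsto_of_tendsto_of_tendsto_of_le_of_le' tendsto_const_nhds hsum
    (Eventually.of_forall fun _ => zero_le) ?_
  filter_upwards [eventually_gt_atTop 0, hγ_lim.eventually_le_const one_pos,
    eventually_mul_le hγ_lim (‖g₀‖ ^ 2) hδ] with n hn hγ1 hreg
  -- The failure event is covered by the deviation events; monotonicity of outer measure suffices,
  -- so no measurability of the error as a function of the sample is needed.
  refine le_trans (measure_mono ?_) ((measure_union_le _ _).trans
    (add_le_add (hdev₁ (γ n) (hγ n) hγ1 0 (by simp) (h n) (hh n) n hn)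
      (hdev₂ (γ n) (hγ n) hγ1 n hn)))
  intro ω hω
  by_contra hcon
  simp only [Set.mem_union, Set.mem_ofPred_eq, not_or, not_le] at hcon
  obtain ⟨⟨d1, d2⟩, d3⟩ := hcon
  obtain ⟨g, hmin, hfT⟩ := hf.exists_minimizer hΦ hγ hn (fun i : Fin n => ω i)
  have hle := hgood (γ n) (hγ n) hγ1 hreg n (fun i : Fin n => ω i) 0 0 g (h n) hn (hh n)
    (by rw [sub_self, abs_zero]; exact (mul_pos (hγ n) hη).le) d1.le d2.le d3.le
    (hmin _) (hmin _)
  have hω' : ε ≤ dist (generalizationError P (f n fun i => ω i)) (bayesError P) := hω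
  rw [hfT, Real.dist_eq, abs_of_nonneg
    (sub_nonneg.mpr (bayesError_le P (continuous_decision hΦc 0 g).measurable))] at hω'
  linarith

/-- Borel–Cantelli from a bound valid only for large `n`: the initial sets are replaced by `∅`. -/
theorem ae_eventually_notMem_of_summable {Ω : Type*} [MeasurableSpace Ω] {μ : Measure Ω}
    {s : ℕ → Set Ω} {u : ℕ → ℝ} (hu0 : ∀ n, 0 ≤ u n) (hu : Summable u)
    (h : ∀ᶠ n in atTop, μ (s n) ≤ ENNReal.ofReal (u n)) : ∀ᵐ ω ∂μ, ∀ᶠ n in atTop, ω ∉ s n := by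
  classical
  obtain ⟨N, hN⟩ := eventually_atTop.mp h
  have := ae_eventually_notMem (μ := μ) (s := fun n => if N ≤ n then s n else ∅) (by
    refine ne_top_of_le_ne_top (ENNReal.ofReal_ne_top (r := ∑' n, u n)) ?_
    rw [ENNReal.ofReal_tsum_of_nonneg hu0 hu]
    refine ENNReal.tsum_le_tsum fun n => ?_
    split_ifs with hn
    · exact hN n hn
    · simp)
  filter_upwards [this] with ω hω
  filter_upwards [hω, eventually_ge_atTop N] with n h1 h2
  simpa [h2] using h1

/-- If all labels are almost surely equal, the classifier with offset is eventually optimal. -/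
theorem tendsto_generalizationError_of_label_const {𝓧 : Type*} [MeasurableSpace 𝓧]
    {K : 𝓧 → 𝓧 → ℝ} {ρ : ℝ} {γ : ℕ → ℝ} {f : ∀ n : ℕ, (Fin n → 𝓧 × Label) → 𝓧 → ℝ}
    (hf : IsCRegClassifier K ρ γ f) (P : Measure (𝓧 × Label)) [IsProbabilityMeasure P] {y : Label}
    (hy : ∀ᵐ z ∂P, z.2 = y) :
    ∀ᵐ ω ∂(Measure.infinitePi fun _ : ℕ => P),
      Tendsto (fun n : ℕ => generalizationError P (f n fun i => ω i)) atTop (𝓝 (bayesError P)) := by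
  have hall : ∀ᵐ ω ∂(Measure.infinitePi fun _ : ℕ => P), ∀ i, (ω i).2 = y :=
    ae_all_iff.mpr fun i =>
      (measurePreserving_eval_infinitePi (fun _ : ℕ => P) i).quasiMeasurePreserving.ae hy
  have hzero : ∀ a : ℝ, 0 < (y : ℝ) * a → generalizationError P (fun _ => a) = 0 := fun a ha => by
    rw [generalizationError, measureReal_eq_zero_iff, measure_eq_zero_iff_ae_notMem]
    filter_upwards [hy] with z hz
    rintro (⟨h1, h2⟩ | ⟨h1, h2⟩) <;> rw [hz] at h1 <;> rw [h1] at ha <;> linarith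
  have hbayes : bayesError P = 0 := by
    refine le_antisymm ?_ (Real.iInf_nonneg fun f => measureReal_nonneg)
    rw [← hzero y (by rcases label_coe y with h | h <;> rw [h] <;> norm_num)]
    exact bayesError_le P measurable_const
  filter_upwards [hall] with ω hω
  rw [hbayes]
  refine tendsto_const_nhds.congr' ?_
  filter_upwards [eventually_gt_atTop 0] with n hn
  obtain ⟨a, ha, hfa⟩ := (hf n hn fun i => ω i).2 y fun i => hω i
  rw [hfa, hzero a ha]

/-- If `s` has absolute value `1` and mean `±1`, it is almost surely constant. -/
theorem ae_label_eq_of_abs_integral {𝓧 : Type*} [MeasurableSpace 𝓧] (P : Measure (𝓧 × Label))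
    [IsProbabilityMeasure P] (h : 1 ≤ |∫ z, labelSign z ∂P|) : ∃ y : Label, ∀ᵐ z ∂P, z.2 = y := by
  have hinteg : Integrable (labelSign : 𝓧 × Label → ℝ) P :=
    Integrable.of_bound measurable_labelSign.aestronglyMeasurable 1 (ae_of_all _ abs_labelSign_le)
  have key : ∀ y : Label, 1 ≤ (y : ℝ) * ∫ z, labelSign z ∂P → ∀ᵐ z ∂P, z.2 = y := fun y hy => by
    have hnn : ∀ z : 𝓧 × Label, 0 ≤ 1 - (y : ℝ) * labelSign z := fun z => by
      have h1 := (le_abs_self ((y : ℝ) * labelSign z))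
      rw [abs_mul, abs_label_coe, one_mul] at h1
      linarith [abs_labelSign_le z]
    have hi : Integrable (fun z : 𝓧 × Label => 1 - (y : ℝ) * labelSign z) P :=
      (integrable_const _).sub (hinteg.const_mul _)
    have h0 : ∫ z, (1 - (y : ℝ) * labelSign z) ∂P = 0 := by
      refine le_antisymm ?_ (integral_nonneg hnn)
      rw [integral_sub (integrable_const _) (hinteg.const_mul _), integral_const_mul]
      simpa using hy
    filter_upwards [(integral_eq_zero_iff_of_nonneg hnn hi).mp h0] with z hz
    have hz' : 1 - (y : ℝ) * (z.2 : ℝ) = 0 := hz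
    refine Subtype.ext ?_
    rcases label_coe y with h | h <;> rw [h] at hz' ⊢ <;> linarith
  rcases le_abs.mp h with h | h
  · exact ⟨posLabel, key posLabel (by simpa [posLabel] using h)⟩
  · exact ⟨negLabel, key negLabel (by simpa [negLabel] using h)⟩

theorem empMean_label_freq {𝓧 : Type*} {n : ℕ} (hn : 0 < n) (T : Fin n → 𝓧 × Label) (y : ℝ) :
    empMean T (fun z => (1 + y * labelSign z) / 2) = (1 + y * empMean T labelSign) / 2 := by
  have h1 : (fun z : 𝓧 × Label => (1 + y * labelSign z) / 2) =
      fun z => 1 / 2 + labelSign z * (y / 2) := by ext z; ring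
  rw [h1, empMean_add, empMean_const hn, empMean_mul_const]; ring

/-- From `γ * ‖g‖ ^ 2 ≤ 2` and `γ ≤ 1` one gets the cruder `‖g‖ ≤ 2 / γ`. This puts the offset on
the scale `1 / γ`, the one the deviation bounds tolerate. -/
theorem abs_offset_le_div {𝓧 H : Type*} [NormedAddCommGroup H] [InnerProductSpace ℝ H]
    {φ φ' : ℝ → ℝ} {L M κ γ p : ℝ} {Φ : 𝓧 → H} (hφ : IsMarginLoss φ φ' L M)
    (hκ : ∀ x, ‖Φ x‖ ≤ κ) (hκ0 : 0 ≤ κ) (hγ : 0 < γ) (hγ1 : γ ≤ 1)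
    {n : ℕ} {T : Fin n → 𝓧 × Label} {α : ℝ} {g : H}
    (hle : regEmpRisk φ (labelFeature Φ) labelSign γ T α g ≤ 1) (hp : 0 < p)
    (hpos : p ≤ empMean T (fun z => (1 + 1 * labelSign z) / 2))
    (hneg : p ≤ empMean T (fun z => (1 + -1 * labelSign z) / 2)) :
    |α| ≤ (2 * κ + 1 / (-φ' 0 * p)) / γ := by
  have h1 := abs_offset_le hφ hκ hγ hle hp hpos hneg
  have h2 := mul_sq_norm_le_two hφ hle
  have h3 : ‖g‖ ≤ 2 / γ := by
    rw [le_div_iff₀ hγ]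
    have h4 : (‖g‖ * γ) ^ 2 ≤ 2 ^ 2 := by
      calc (‖g‖ * γ) ^ 2 = γ * ‖g‖ ^ 2 * γ := by ring
        _ ≤ 2 * 1 := mul_le_mul h2 hγ1 hγ.le (by norm_num)
        _ ≤ 2 ^ 2 := by norm_num
    exact (abs_le_of_sq_le_sq' h4 (by norm_num)).2
  have h4 : 0 < 1 / (-φ' 0 * p) := one_div_pos.mpr (mul_pos (by linarith [hφ.neg]) hp)
  have h5 : 1 / (-φ' 0 * p) ≤ 1 / (-φ' 0 * p) / γ := by
    rw [le_div_iff₀ hγ]; exact mul_le_of_le_one_right h4.le hγ1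
  have h6 := mul_le_mul_of_nonneg_left h3 hκ0
  rw [add_div]
  have h7 : 2 * κ / γ = κ * (2 / γ) := by ring
  rw [h7]; linarith

end Classifiers

/-! ### The classifier with offset: discretization and Borel–Cantelli -/

section Offset

variable {𝓧 : Type*} [MeasurableSpace 𝓧] [TopologicalSpace 𝓧] [BorelSpace 𝓧]
  [SecondCountableTopology 𝓧] [T2Space 𝓧] [CompactSpace 𝓧]
  {H : Type*} [NormedAddCommGroup H] [InnerProductSpace ℝ H] [CompleteSpace H]
  {φ' : ℝ → ℝ} {L M : ℝ} {K : 𝓧 → 𝓧 → ℝ} {Φ : 𝓧 → H} {κ ρ : ℝ} {γ : ℕ → ℝ}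

/-- The growth condition on `n γ² / log n` makes polynomially many exponential bounds summable. -/
theorem eventually_exp_neg_le {γ : ℕ → ℝ}
    (hrate : Tendsto (fun n : ℕ => (n : ℝ) * γ n ^ 2 / Real.log n) atTop atTop) {c : ℝ}
    (hc : 0 < c) : ∀ᶠ n : ℕ in atTop, Real.exp (-(c * (n * γ n ^ 2))) ≤ 1 / (n : ℝ) ^ 3 := by
  -- The exponent `3` leaves the summable `1 / n ^ 2` after a union bound over `O(n)` grid points.
  filter_upwards [hrate.eventually_ge_atTop (3 / c), eventually_gt_atTop 1] with n hn hn1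
  have hn' : (1 : ℝ) < n := by exact_mod_cast hn1
  have hlog := Real.log_pos hn'
  rw [div_le_div_iff₀ hc hlog] at hn
  calc Real.exp (-(c * (n * γ n ^ 2))) ≤ Real.exp (-(3 * Real.log n)) :=
        Real.exp_le_exp.mpr (by linarith)
    _ = 1 / (n : ℝ) ^ 3 := by
        rw [Real.exp_neg, mul_comm, Real.exp_mul, Real.exp_log (by linarith)]
        norm_num

theorem eventually_one_le_mul_sq {γ : ℕ → ℝ}
    (hrate : Tendsto (fun n : ℕ => (n : ℝ) * γ n ^ 2 / Real.log n) atTop atTop) :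
    ∀ᶠ n : ℕ in atTop, 1 ≤ (n : ℝ) * γ n ^ 2 := by
  filter_upwards [hrate.eventually_ge_atTop 1, eventually_ge_atTop 3] with n hn hn3
  have hn' : (3 : ℝ) ≤ n := by exact_mod_cast hn3
  have hlog : 1 ≤ Real.log n := by
    rw [Real.le_log_iff_exp_le (by linarith)]
    linarith [Real.exp_one_lt_d9]
  rw [le_div_iff₀ (by linarith)] at hn
  linarith

/-- The grid has about `2 A / (γ² η)` points, and `1 / γ²` is at most `n`. -/
theorem card_offsetGrid_le {A η γ : ℝ} {n : ℕ} (hA : 0 ≤ A) (hη : 0 < η) (hn : 0 < n)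
    (hγ : 0 < γ) (h : 1 ≤ (n : ℝ) * γ ^ 2) :
    ((Finset.Icc (-⌊A / (γ ^ 2 * η)⌋) ⌊A / (γ ^ 2 * η)⌋).card : ℝ) ≤ (2 * (A / η) + 1) * n := by
  have hn' : (1 : ℝ) ≤ n := by exact_mod_cast hn
  have h0 : 0 ≤ ⌊A / (γ ^ 2 * η)⌋ := Int.floor_nonneg.mpr (by positivity)
  have h1 : ((Finset.Icc (-⌊A / (γ ^ 2 * η)⌋) ⌊A / (γ ^ 2 * η)⌋).card : ℤ) =
      2 * ⌊A / (γ ^ 2 * η)⌋ + 1 := by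
    rw [Int.card_Icc, Int.toNat_of_nonneg (by omega)]; ring
  have h2 : ((Finset.Icc (-⌊A / (γ ^ 2 * η)⌋) ⌊A / (γ ^ 2 * η)⌋).card : ℝ) =
      2 * (⌊A / (γ ^ 2 * η)⌋ : ℝ) + 1 := by exact_mod_cast h1
  rw [h2]
  have h3 := Int.floor_le (A / (γ ^ 2 * η))
  have h4 : A / (γ ^ 2 * η) ≤ A / η * n := by
    rw [div_le_iff₀ (by positivity)]
    calc A = A * 1 := (mul_one A).symm
      _ ≤ A * (n * γ ^ 2) := mul_le_mul_of_nonneg_left h hA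
      _ = _ := by field_simp
  nlinarith

/-- Rounding down to a multiple of `γ * η` may leave the interval of radius `A / γ`, but by at most
`γ * η ≤ η / γ`; hence the radius `A + η`. -/
theorem exists_offsetGrid {A η γ α : ℝ} (hη : 0 < η) (hγ : 0 < γ) (hγ1 : γ ≤ 1)
    (hα : |α| ≤ A / γ) :
    ∃ k ∈ Finset.Icc (-⌊(A + η) / (γ ^ 2 * η)⌋) ⌊(A + η) / (γ ^ 2 * η)⌋,
      |α - γ * η * (k : ℝ)| ≤ γ * η := by
  have hp : 0 < γ * η := by positivity
  set k := ⌊α / (γ * η)⌋ with hk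
  have h1 : (k : ℝ) * (γ * η) ≤ α := by
    rw [← le_div_iff₀ hp]; exact Int.floor_le _
  have h2 : α < (k + 1 : ℝ) * (γ * η) := by
    rw [← div_lt_iff₀ hp]; exact Int.lt_floor_add_one _
  have hdist : |α - γ * η * (k : ℝ)| ≤ γ * η := abs_le.mpr ⟨by linarith, by linarith⟩
  have h3 : γ * η ≤ η / γ := by
    rw [le_div_iff₀ hγ]
    calc γ * η * γ = η * (γ * γ) := by ring
      _ ≤ η * 1 := mul_le_mul_of_nonneg_left (mul_le_one₀ hγ1 hγ.le hγ1) hη.le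
      _ = η := mul_one η
  have h4 : |γ * η * (k : ℝ)| ≤ (A + η) / γ := by
    have := abs_sub_abs_le_abs_sub (γ * η * (k : ℝ)) α
    rw [abs_sub_comm] at this
    rw [add_div]; linarith
  have h5 : |(k : ℝ)| ≤ (A + η) / (γ ^ 2 * η) := by
    rw [abs_mul, abs_of_pos hp, le_div_iff₀ hγ] at h4
    rw [le_div_iff₀ (by positivity)]
    linarith
  rw [abs_le] at h5
  refine ⟨k, Finset.mem_Icc.mpr ⟨?_, Int.le_floor.mpr h5.2⟩, hdist⟩
  have : -k ≤ ⌊(A + η) / (γ ^ 2 * η)⌋ := Int.le_floor.mpr (by push_cast; linarith)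
  omega

theorem abs_offsetGrid_le {A η γ : ℝ} (hη : 0 < η) (hγ : 0 < γ) {k : ℤ}
    (hk : k ∈ Finset.Icc (-⌊A / (γ ^ 2 * η)⌋) ⌊A / (γ ^ 2 * η)⌋) :
    |γ * η * (k : ℝ)| ≤ A / γ := by
  rw [Finset.mem_Icc] at hk
  have h0 : |k| ≤ ⌊A / (γ ^ 2 * η)⌋ := abs_le.mpr hk
  have h1 : |(k : ℝ)| ≤ A / (γ ^ 2 * η) := by
    have := Int.le_floor.mp h0
    rwa [Int.cast_abs] at this
  rw [abs_mul, abs_of_pos (mul_pos hγ hη)]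
  calc γ * η * |(k : ℝ)| ≤ γ * η * (A / (γ ^ 2 * η)) := by gcongr
    _ = A / γ := by field_simp

/-- The random offset is rounded to a grid point, and `hgood` is applied with the stationary point
there. Outside the bad set `B n` the deviations are small at all grid points simultaneously, so it
does not matter which one the sample selects. -/
theorem ae_eventually_generalizationError_le (hφ : IsMarginLoss (cLoss ρ 1) φ' L M)
    (hΦ : ∀ x y, inner ℝ (Φ x) (Φ y) = K x y) (hΦc : Continuous Φ) (hκ0 : 0 < κ)
    (hκ : ∀ x, ‖Φ x‖ ≤ κ)
    (hdense : ∀ u : C(𝓧, ℝ), ∀ ε > 0, ∃ g : H, ∀ x, |u x - inner ℝ (Φ x) g| ≤ ε)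
    (hγ : ∀ n, 0 < γ n) (hγ_lim : Tendsto γ atTop (𝓝 0))
    (hrate : Tendsto (fun n : ℕ => (n : ℝ) * γ n ^ 2 / Real.log n) atTop atTop)
    {f : ∀ n : ℕ, (Fin n → 𝓧 × Label) → 𝓧 → ℝ} (hf : IsCRegClassifier K ρ γ f)
    (P : Measure (𝓧 × Label)) [IsProbabilityMeasure P] (hm : |∫ z, labelSign z ∂P| < 1)
    {ε : ℝ} (hε : 0 < ε) :
    ∀ᵐ ω ∂(Measure.infinitePi fun _ : ℕ => P), ∀ᶠ n : ℕ in atTop,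
      bayesError P ≤ generalizationError P (f n fun i => ω i) ∧
      generalizationError P (f n fun i => ω i) ≤ bayesError P + ε := by
  set φ := cLoss ρ 1
  set Ψ := labelFeature Φ
  have hΨm := stronglyMeasurable_labelFeature hΦc
  obtain ⟨g₀, η, δ, hη, hδ, hgood⟩ := exists_generalizationError_le hφ P hΦc hκ0 hκ hdense hε
  choose h hh using fun n α => exists_stationary hφ P hΨm measurable_labelSign
    (norm_labelFeature_le hκ) (hγ n) α
  set m := ∫ z, labelSign z ∂P with hmdef
  -- If the empirical label mean is within `(1 - |m|) / 2` of `m`, its absolute value is at most `(1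
  -- + |m|) / 2`, so each label has frequency at least `p`.
  set p := (1 - |m|) / 4 with hp
  have hp0 : 0 < p := by linarith
  set A := 2 * κ + 1 / (-φ' 0 * p) with hA
  have hA0 : 0 ≤ A := by
    have : 0 < 1 / (-φ' 0 * p) := one_div_pos.mpr (mul_pos (by linarith [hφ.neg]) hp0)
    positivity
  obtain ⟨c₁, hc₁, hdev₁⟩ := exists_measure_deviation_le hφ P hΦc hκ0 hκ
    (add_nonneg hA0 hη.le) hη hδ
  obtain ⟨c₂, hc₂, hdev₂⟩ := exists_measure_deviation_fixed_le P
    (F := fun z => φ (margin Ψ labelSign 0 g₀ z)) (B := 1 + L * (κ * ‖g₀‖ + |0|))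
    (hφ.continuous.measurable.comp
      (stronglyMeasurable_margin hΨm measurable_labelSign 0 g₀).measurable) (fun z => by
      rw [abs_of_nonneg (hφ.nonneg _)]
      have := mul_le_mul_of_nonneg_left
        (abs_margin_le (norm_labelFeature_le hκ) abs_labelSign_le 0 g₀ z) hφ.L_pos.le
      linarith [hφ.le_one_add (margin Ψ labelSign 0 g₀ z)]) hδ
  obtain ⟨c₃, hc₃, hdev₃⟩ := exists_measure_deviation_fixed_le P measurable_labelSign
    abs_labelSign_le (show 0 < (1 - |m|) / 2 by linarith)
  set grid : ℕ → Finset ℤ := fun n =>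
    Finset.Icc (-⌊(A + η) / (γ n ^ 2 * η)⌋) ⌊(A + η) / (γ n ^ 2 * η)⌋
  set bad : ℕ → ℝ → Set (ℕ → 𝓧 × Label) := fun n α =>
    {ω | γ n * η ≤ ‖empMean (fun i : Fin n => ω i)
        (fun z => φ' (margin Ψ labelSign α (h n α) z) • Ψ z) -
        ∫ z, φ' (margin Ψ labelSign α (h n α) z) • Ψ z ∂P‖} ∪
    {ω | δ ≤ ‖empMean (fun i : Fin n => ω i) (fun z => φ (margin Ψ labelSign α (h n α) z)) -
        ∫ z, φ (margin Ψ labelSign α (h n α) z) ∂P‖} with hbad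
  set B : ℕ → Set (ℕ → 𝓧 × Label) := fun n =>
    (⋃ k ∈ grid n, bad n (γ n * η * (k : ℝ))) ∪
    ({ω | δ ≤ ‖empMean (fun i : Fin n => ω i) (fun z => φ (margin Ψ labelSign 0 g₀ z)) -
        ∫ z, φ (margin Ψ labelSign 0 g₀ z) ∂P‖} ∪
      {ω | (1 - |m|) / 2 ≤ ‖empMean (fun i : Fin n => ω i) labelSign -
        ∫ z, labelSign z ∂P‖}) with hB
  -- The first term pays for the grid, each point costing `4 / n ^ 3`; the final `4` pays `2` for
  -- each of the two remaining events.
  set C := 4 * (2 * ((A + η) / η) + 1) + 4 with hC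
  have hC0 : 0 ≤ C := by positivity
  have hBmeas : ∀ᶠ n in atTop, (Measure.infinitePi fun _ : ℕ => P) (B n) ≤
      ENNReal.ofReal (C * (1 / (n : ℝ) ^ 2)) := by
    filter_upwards [eventually_gt_atTop 0, hγ_lim.eventually_le_const one_pos,
      eventually_exp_neg_le hrate hc₁, eventually_exp_neg_le hrate hc₂,
      eventually_exp_neg_le hrate hc₃, eventually_one_le_mul_sq hrate] with n hn hγ1 e1 e2 e3 hone
    have hn' : (1 : ℝ) ≤ n := by exact_mod_cast hn
    have hU : (Measure.infinitePi fun _ : ℕ => P) (⋃ k ∈ grid n, bad n (γ n * η * (k : ℝ))) ≤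
        ENNReal.ofReal ((2 * ((A + η) / η) + 1) * n * (4 * (1 / (n : ℝ) ^ 3))) := by
      refine (measure_biUnion_finset_le _ _).trans ?_
      calc ∑ k ∈ grid n, (Measure.infinitePi fun _ : ℕ => P) (bad n (γ n * η * (k : ℝ)))
          ≤ ∑ k ∈ grid n, ENNReal.ofReal (4 * (1 / (n : ℝ) ^ 3)) := by
            refine Finset.sum_le_sum fun k hk => ?_
            refine (hdev₁ (γ n) (hγ n) hγ1 _ (abs_offsetGrid_le hη (hγ n) hk) _ (hh n _) n hn).trans
              (ENNReal.ofReal_le_ofReal ?_)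
            linarith
        _ = ENNReal.ofReal ((grid n).card * (4 * (1 / (n : ℝ) ^ 3))) := by
            rw [Finset.sum_const, nsmul_eq_mul, ENNReal.ofReal_mul (Nat.cast_nonneg (grid n).card),
              ENNReal.ofReal_natCast]
        _ ≤ _ := by
            refine ENNReal.ofReal_le_ofReal (mul_le_mul_of_nonneg_right ?_ (by positivity))
            exact card_offsetGrid_le (add_nonneg hA0 hη.le) hη hn (hγ n) hone
    have h2 := (hdev₂ (γ n) (hγ n) hγ1 n hn).trans
      (ENNReal.ofReal_le_ofReal (mul_le_mul_of_nonneg_left e2 zero_le_two))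
    have h3 := (hdev₃ (γ n) (hγ n) hγ1 n hn).trans
      (ENNReal.ofReal_le_ofReal (mul_le_mul_of_nonneg_left e3 zero_le_two))
    refine (measure_union_le _ _).trans ((add_le_add hU ((measure_union_le _ _).trans
      (add_le_add h2 h3))).trans ?_)
    rw [← ENNReal.ofReal_add (by positivity) (by positivity),
      ← ENNReal.ofReal_add (by positivity) (by positivity)]
    refine ENNReal.ofReal_le_ofReal ?_
    have h4 : (2 * ((A + η) / η) + 1) * n * (4 * (1 / (n : ℝ) ^ 3)) =
        4 * (2 * ((A + η) / η) + 1) * (1 / (n : ℝ) ^ 2) := by field_simp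
    have h5 : 1 / (n : ℝ) ^ 3 ≤ 1 / (n : ℝ) ^ 2 :=
      one_div_le_one_div_of_le (by positivity) (pow_le_pow_right₀ hn' (by norm_num))
    rw [h4, hC, add_mul]
    linarith
  have hsumm : Summable fun n : ℕ => C * (1 / (n : ℝ) ^ 2) :=
    (Real.summable_one_div_nat_pow.mpr (by norm_num)).mul_left C
  filter_upwards [ae_eventually_notMem_of_summable (fun n => by positivity) hsumm hBmeas]
    with ω hω
  filter_upwards [hω, eventually_gt_atTop 0, hγ_lim.eventually_le_const one_pos,
    eventually_mul_le hγ_lim (‖g₀‖ ^ 2) hδ] with n hnB hn hγ1 hreg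
  have hn' : (1 : ℝ) ≤ n := by exact_mod_cast hn
  simp only [hB, Set.mem_union, Set.mem_iUnion, Set.mem_ofPred_eq, not_or, not_le, not_exists]
    at hnB
  obtain ⟨hgridn, d3, d4⟩ := hnB
  set T : Fin n → 𝓧 × Label := fun i => ω i with hT
  rw [Real.norm_eq_abs, abs_lt] at d4
  have hfreq : ∀ y : ℝ, y = 1 ∨ y = -1 →
      p ≤ empMean T (fun z => (1 + y * labelSign z) / 2) := fun y hy => by
    rw [empMean_label_freq hn]
    have h1 := neg_abs_le m
    have h2 := le_abs_self m
    rcases hy with rfl | rfl <;> linarith [d4.1, d4.2]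
  -- If all labels agreed, the opposite label would have frequency `0`, contradicting the lower
  -- bound `p`.
  have hboth : ∃ i j, (T i).2 ≠ (T j).2 := by
    by_contra hcon
    push Not at hcon
    have hconst := hfreq (-((T ⟨0, hn⟩).2 : ℝ))
      (by rcases label_coe (T ⟨0, hn⟩).2 with h | h <;> rw [h] <;> norm_num)
    have hz : empMean T (fun z => (1 + -((T ⟨0, hn⟩).2 : ℝ) * labelSign z) / 2) = 0 := by
      simp only [empMean]
      rw [Finset.sum_eq_zero, smul_zero]
      intro i _
      simp only [labelSign, hcon i ⟨0, hn⟩]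
      rcases label_coe (T ⟨0, hn⟩).2 with h | h <;> rw [h] <;> norm_num
    linarith
  obtain ⟨α, g, hmin, hfT⟩ := hf.exists_minimizer hΦ hγ hn T hboth
  have hle1 : regEmpRisk φ Ψ labelSign (γ n) T α g ≤ 1 :=
    (hmin 0 0).trans_eq (regEmpRisk_zero hφ hn T)
  have hα : |α| ≤ A / γ n := abs_offset_le_div hφ hκ hκ0.le (hγ n) hγ1 hle1 hp0
    (hfreq 1 (Or.inl rfl)) (hfreq (-1) (Or.inr rfl))
  obtain ⟨k, hk, hkα⟩ := exists_offsetGrid hη (hγ n) hγ1 hα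
  have hnk := hgridn k hk
  simp only [hbad, Set.mem_union, Set.mem_ofPred_eq, not_or, not_le] at hnk
  rw [hfT]
  exact ⟨bayesError_le P (continuous_decision hΦc α g).measurable,
    hgood (γ n) (hγ n) hγ1 hreg n T α _ g _ hn (hh n _) hkα hnk.1.le hnk.2.le d3.le
      (hmin _ _) (hmin _ _)⟩

theorem stronglyUniversallyConsistent_offset (hφ : IsMarginLoss (cLoss ρ 1) φ' L M)
    (hΦ : ∀ x y, inner ℝ (Φ x) (Φ y) = K x y) (hΦc : Continuous Φ) (hκ0 : 0 < κ)
    (hκ : ∀ x, ‖Φ x‖ ≤ κ)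
    (hdense : ∀ u : C(𝓧, ℝ), ∀ ε > 0, ∃ g : H, ∀ x, |u x - inner ℝ (Φ x) g| ≤ ε)
    (hγ : ∀ n, 0 < γ n) (hγ_lim : Tendsto γ atTop (𝓝 0))
    (hrate : Tendsto (fun n : ℕ => (n : ℝ) * γ n ^ 2 / Real.log n) atTop atTop)
    {f : ∀ n : ℕ, (Fin n → 𝓧 × Label) → 𝓧 → ℝ} (hf : IsCRegClassifier K ρ γ f) :
    StronglyUniversallyConsistent f := by
  intro P _
  -- The mean label has absolute value `1` exactly when the label is almost surely constant, and
  -- then no positive lower bound `p` on both frequencies exists.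
  rcases lt_or_ge |∫ z, labelSign z ∂P| 1 with hm | hm
  · have hall : ∀ᵐ ω ∂(Measure.infinitePi fun _ : ℕ => P), ∀ j : ℕ, ∀ᶠ n : ℕ in atTop,
        bayesError P ≤ generalizationError P (f n fun i => ω i) ∧
        generalizationError P (f n fun i => ω i) ≤ bayesError P + 1 / ((j : ℝ) + 1) :=
      ae_all_iff.mpr fun j => ae_eventually_generalizationError_le hφ hΦ hΦc hκ0 hκ hdense hγ
        hγ_lim hrate hf P hm (by positivity)
    filter_upwards [hall] with ω hω
    rw [Metric.tendsto_atTop']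
    intro ε hε
    obtain ⟨j, hj⟩ := exists_nat_one_div_lt hε
    obtain ⟨N, hN⟩ := eventually_atTop.mp (hω j)
    refine ⟨N, fun n hn => ?_⟩
    obtain ⟨h1, h2⟩ := hN n hn.le
    rw [Real.dist_eq, abs_of_nonneg (sub_nonneg.mpr h1)]
    linarith
  · obtain ⟨y, hy⟩ := ae_label_eq_of_abs_integral P hm
    exact tendsto_generalizationError_of_label_const hf P hy

end Offset

/-! ### The main theorem -/

theorem mainTheorem2 {d : ℕ} (X : Set (EuclideanSpace ℝ (Fin d))) (hX : IsCompact X)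
    (K : X → X → ℝ) (hK : IsUniversalKernel K) (ρ : ℝ) (hρ : 0 < ρ)
    (γ : ℕ → ℝ) (hγ_pos : ∀ n, 0 < γ n) (hγ_lim : Tendsto γ atTop (𝓝 0)) :
    ((∃ f, IsCRegClassifier K ρ γ f) ∧
      (Tendsto (fun n : ℕ => (n : ℝ) * γ n ^ 2 / Real.log n) atTop atTop →
        ∀ f, IsCRegClassifier K ρ γ f → StronglyUniversallyConsistent f)) ∧
    ((∃ f, IsCRegClassifierNoOffset K ρ γ f) ∧
      (Tendsto (fun n : ℕ => (n : ℝ) * γ n ^ 2) atTop atTop →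
        ∀ f, IsCRegClassifierNoOffset K ρ γ f → UniversallyConsistent f)) := by
  have : CompactSpace X := isCompact_iff_compactSpace.mp hX
  obtain ⟨φ', L, M, hφ⟩ := exists_isMarginLoss_cLoss hρ
  obtain ⟨H, _, _, _, Φ, hΦc, hΦ, hdense⟩ := hK.exists_featureMap
  obtain ⟨b, hb⟩ := isCompact_univ.exists_bound_of_continuousOn hΦc.continuousOn
  -- The maximum with `1` keeps the feature bound positive even when the supplied bound `b` is not,
  -- for instance on an empty `X`; later constants divide by it.
  have hκ0 : 0 < max b 1 := lt_max_of_lt_right one_pos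
  have hκ : ∀ x, ‖Φ x‖ ≤ max b 1 := fun x => (hb x trivial).trans (le_max_left _ _)
  exact ⟨⟨exists_isCRegClassifier hΦ hφ hγ_pos hκ, fun hrate f hf =>
      stronglyUniversallyConsistent_offset hφ hΦ hΦc hκ0 hκ hdense hγ_pos hγ_lim hrate hf⟩,
    ⟨exists_isCRegClassifierNoOffset hΦ hφ hγ_pos, fun hrate f hf =>
      universallyConsistent_noOffset hφ hΦ hΦc hκ0 hκ hdense hγ_pos hγ_lim hrate hf⟩⟩
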